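/- Let $\mathbb K=\mathbb R$ or $\mathbb C$, let $\mathfrak s$ be a (finite-dimensional) semisimple Lie algebra over $\mathbb K$ and $\mathfrak g=\mathfrak s\oplus\mathbb K$ its one-dimensional trivial central extension, with canonical Lie--Poisson bivector $\pi_1$ on $\mathfrak g^*=\mathfrak s^*\oplus\mathbb K^*$. Let $x_1,\dots,x_n$ be linear coordinates on $\mathfrak s^*$, let $0\neq a\in\mathbb K^*\subset\mathfrak g^*$, and let $x_0$ be the linear coordinate on $\mathfrak g^*$ with $x_0|_{\mathfrak s^*}=0$, $x_0(a)=1$. For a bivector $P$ and a function $f$ let $P(f)$ be the vector field $P(f)^i=\sum_j P^{ij}\,\partial f/\partial x_j$ with $P^{ij}=P(dx_i,dx_j)$; $f$ is a Casimir function of $P$ if $P(f)=0$. Let $\pi_2$ be a quadratic Poisson bivector on $\mathfrak g^*$ which is centrally linearizable (CL) at $a$, i.e. $\pi_2(a)=0$ and the linearization $[\partial/\partial x_0,\pi_2]$ of $\pi_2$ at $a$ equals $\pi_1$, and suppose that $$\pi_2=\mathcal L_{\widetilde X}\pi_1,\qquad \widetilde X=X+q\,\frac{\partial}{\partial x_0}-x_0E,$$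 where $X$ is a quadratic vector field and $q$ a homogeneous quadratic polynomial on $\mathfrak s^*$ (both independent of $x_0$), and $E=\sum_{i=1}^n x_i\,\partial/\partial x_i$. Put $\pi=\mathcal L_X\pi_1$. On $\mathfrak s^*$ we write $\pi_1$ also for the Lie--Poisson bivector of $\mathfrak s^*$. All functions are $C^\infty$ if $\mathbb K=\mathbb R$ (in particular, they may be analytic) and holomorphic if $\mathbb K=\mathbb C$. 1. Let $r=r_0+x_0r_1+\dots+x_0^kr_k$, $k\ge 0$, where $r_0,\dots,r_k$ are functions of $x_1,\dots,x_n$, and put $r_i=0$ for $i<0$ and $i>k$. Then $r$ is a Casimir function of $\pi_2$ if and only if the following identities hold on $\mathfrak s^*$: $$\pi_1(q)r_i=0\quad(0\le i\le k),$$ $$\pi(r_0)-r_1\pi_1(q)=0,$$ $$\pi(r_i)-(i+1)\,r_{i+1}\,\pi_1(q)+\pi_1(r_{i-1})=0\quad(1\le i\le k-1),$$ $$\pi(r_k)+\pi_1(r_{k-1})=0,\qquad \pi_1(r_k)=0.$$ 2. If a function $r_k$ on $\mathfrak s^*$ satisfies $\pi_1(r_k)=0$, then for every Casimir function $r'_{k-1}$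 of $\pi_1$ on $\mathfrak s^*$ the function $r_{k-1}=Xr_k+r'_{k-1}$ satisfies $\pi(r_k)+\pi_1(r_{k-1})=0$; moreover, $\pi_1(q)r_{k-1}=0$. -/

import Mathlib

open scoped ContDiff

attribute [local instance] LieRing.ofAssociativeRing

noncomputable section

namespace CLPoisson

/-! Tensor fields on a coordinate space `ι → 𝕜`, given by their components. -/

section Tensors

variable {𝕜 : Type*} [RCLike 𝕜] {ι : Type*} [Fintype ι] [DecidableEq ι]

/-- Partial derivative `∂f/∂xᵢ`. -/
def pd (i : ι) (f : (ι → 𝕜) → 𝕜) (x : ι → 𝕜) : 𝕜 :=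
  fderiv 𝕜 f x (Pi.single i 1)

/-- Action `X f = ∑ᵢ Xⁱ ∂f/∂xᵢ` of a vector field `X` on a function `f`. -/
def vfAct (X : (ι → 𝕜) → ι → 𝕜) (f : (ι → 𝕜) → 𝕜) (x : ι → 𝕜) : 𝕜 :=
  ∑ i, X x i * pd i f x

/-- The vector field `P(f) = [P, f]`, the contraction of the bivector `P` and `df` over the second
index: `P(f)ⁱ = ∑ⱼ Pⁱʲ ∂f/∂xⱼ`. Here `P x i j = P(dxᵢ, dxⱼ)` at the point `x`. -/
def ham (P : (ι → 𝕜) → ι → ι → 𝕜) (f : (ι → 𝕜) → 𝕜) (x : ι → 𝕜) (i : ι) : 𝕜 :=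
  ∑ j, P x i j * pd j f x

/-- `f` is a Casimir function of the bivector `P`: `P(f) = 0`. -/
def IsCasimir (P : (ι → 𝕜) → ι → ι → 𝕜) (f : (ι → 𝕜) → 𝕜) : Prop :=
  ∀ x, ham P f x = 0

/-- The Lie derivative `[X, P] = L_X P` of the bivector `P` along the vector field `X`. -/
def lieDer (X : (ι → 𝕜) → ι → 𝕜) (P : (ι → 𝕜) → ι → ι → 𝕜) (x : ι → 𝕜) (i j : ι) : 𝕜 :=
  vfAct X (fun y => P y i j) x
    - ∑ l, P x l j * pd l (fun y => X y i) x
    - ∑ l, P x i l * pd l (fun y => X y j) x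

/-- `f` is (the function of) a homogeneous polynomial of degree `d`. -/
def IsHomogPoly (d : ℕ) (f : (ι → 𝕜) → 𝕜) : Prop :=
  ∃ p : MvPolynomial ι 𝕜, p.IsHomogeneous d ∧ ∀ x, f x = MvPolynomial.eval x p

/-- Quadratic Poisson bivector: skew-symmetric, with homogeneous quadratic components, and
satisfying the Jacobi identity `[P, P] = 0`. -/
structure IsQuadraticPoisson (P : (ι → 𝕜) → ι → ι → 𝕜) : Prop where
  skew : ∀ x i j, P x i j = -P x j i
  quadratic : ∀ i j, IsHomogPoly 2 fun x => P x i j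
  jacobi : ∀ x i j k,
    ∑ l, (P x i l * pd l (fun y => P y j k) x
        + P x j l * pd l (fun y => P y k i) x
        + P x k l * pd l (fun y => P y i j) x) = 0

/-- The linearization `[T_a, P]` of a quadratic bivector `P` at `a`, where `T_a` is the constant
vector field with value `a`. -/
def linearization (a : ι → 𝕜) (P : (ι → 𝕜) → ι → ι → 𝕜) : (ι → 𝕜) → ι → ι → 𝕜 :=
  lieDer (fun _ => a) P

end Tensors

section Lie

variable {𝕜 : Type*} [RCLike 𝕜] {ι : Type*} [Fintype ι]

/-- The linear coordinates on the dual `L*` given by a basis `β` of `L`: the coordinates of `ξ` are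
`xᵢ(ξ) = ξ(βᵢ)`. -/
def dualCoords {L : Type*} [AddCommGroup L] [Module 𝕜 L] (β : Module.Basis ι 𝕜 L)
    (ξ : Module.Dual 𝕜 L) (i : ι) : 𝕜 :=
  ξ (β i)

/-- The canonical Lie–Poisson bivector on `L*`, in the coordinates given by a basis `β` of `L`:
`{xᵢ, xⱼ} = ∑ₖ cᵢⱼᵏ xₖ`, where `⁅βᵢ, βⱼ⁆ = ∑ₖ cᵢⱼᵏ βₖ`. -/
def liePoisson {L : Type*} [LieRing L] [LieAlgebra 𝕜 L] (β : Module.Basis ι 𝕜 L)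
    (x : ι → 𝕜) (i j : ι) : 𝕜 :=
  ∑ k, β.repr ⁅β i, β j⁆ k * x k

/-- A quadratic Poisson bivector `P` on the dual of the trivial central extension `𝔰 ⊕ 𝕜`, written in
the coordinates given by a basis `β`, is centrally linearizable at `a`: the point `a` is a nonzero
element of `𝕜* ⊆ 𝔰* ⊕ 𝕜*`, `P` vanishes at `a`, and the linearization of `P` at `a` is the canonical
Lie–Poisson bivector. (The Lie algebra `𝕜` is abelian.) -/
structure IsCentrallyLinearizableAt [DecidableEq ι] {𝔰 : Type*} [LieRing 𝔰] [LieAlgebra 𝕜 𝔰]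
    (β : Module.Basis ι 𝕜 (𝔰 × 𝕜)) (P : (ι → 𝕜) → ι → ι → 𝕜) (a : Module.Dual 𝕜 (𝔰 × 𝕜)) :
    Prop where
  quadraticPoisson : IsQuadraticPoisson P
  central : ∀ y : 𝔰, a (y, 0) = 0
  ne_zero : a ≠ 0
  vanishes : P (dualCoords β a) = 0
  linearization_eq : linearization (dualCoords β a) P = liePoisson (L := 𝔰 × 𝕜) β

end Lie

section Central

variable {𝕜 : Type*} [RCLike 𝕜] {ι : Type*}

/-- The vector field `X̃ = X + q ∂/∂x₀ - x₀ E` on `𝔤* = 𝔰* ⊕ 𝕜*`, where `X` and `q` live on `𝔰*` and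
`E` is the Euler vector field of `𝔰*`. The coordinates of `𝔤*` are `xᵢ`, `i : ι`, with index
`Sum.inl i`, and `x₀` with index `Sum.inr ()`. -/
def tildeField (X : (ι → 𝕜) → ι → 𝕜) (q : (ι → 𝕜) → 𝕜) (x : ι ⊕ Unit → 𝕜) : ι ⊕ Unit → 𝕜 :=
  Sum.elim
    (fun i => X (fun j => x (Sum.inl j)) i - x (Sum.inr ()) * x (Sum.inl i))
    (fun _ => q fun j => x (Sum.inl j))

/-- The function `r = r₀ + x₀ r₁ + ⋯ + x₀ᵏ rₖ` on `𝔤*`, where the `rᵢ` are functions on `𝔰*`. -/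
def polyInX0 (k : ℕ) (r : ℕ → (ι → 𝕜) → 𝕜) (x : ι ⊕ Unit → 𝕜) : 𝕜 :=
  ∑ i ∈ Finset.range (k + 1), x (Sum.inr ()) ^ i * r i fun j => x (Sum.inl j)

end Central

end CLPoisson

end

/-! Part 1 is comparison of coefficients. The bivector `π₁` of `𝔤*` has no `∂/∂x₀` component and is
linear, so `L_E π₁ = -π₁`. Hence `π₂` has horizontal part `π + x₀ π₁` and mixed part `∓π₁(q)`. Each
component of `π₂(r)` is then a polynomial in `x₀` whose coefficients are functions on `𝔰*`, and it
vanishes exactly when all of them do (`isCasimir_polyInX0_iff`, `hamCoeff_eq_zero_iff`).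

In Part 2, the first claim is the Leibniz rule `L_X(π₁(f)) = π(f) + π₁(X f)` with `π₁(f) = 0`
(`ham_lieDer_add_ham_vfAct`). By skew-symmetry of `π₁` and `π`, the second claim reduces to `π(q) f
= 0` for every Casimir function `f` of `π₁`. The Jacobi identity of `π₂`, expanded in `x₀`, says
that `π` and `π₁` are compatible and that `π₁(q)` preserves `π`. Together these imply that `π(q)`
preserves `π₁` (`ham_preserves_of_compatible`). A homogeneous polynomial field preserving `π₁` is a
one-cocycle of `𝔰` with values in a finite-dimensional space of polynomials. Whitehead's first lemma
(`IsLieOneCocycle.exists_eq_lie`) makes it Hamiltonian, and `π₁(h) f = -π₁(f) h = 0`. -/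

/-! ### Whitehead's first lemma -/

section Whitehead

open LieAlgebra LieModule Module

variable {K L : Type*} [Field K] [LieRing L] [LieAlgebra K L]

/-- The canonical element of an invariant form on an ideal is annihilated by the Lie algebra. -/
theorem LieIdeal.sum_lie_dualBasis_add {ι W : Type*} [Fintype ι] [DecidableEq ι]
    [AddCommGroup W] [Module K W] (I : LieIdeal K L) (B : LinearMap.BilinForm K I)
    (hB : B.Nondegenerate) (hsymm : B.IsSymm)
    (hinv : ∀ (z : L) (x y : I), B ⁅z, x⁆ y = - B x ⁅z, y⁆)
    (e : Basis ι K I) (β : I →ₗ[K] I →ₗ[K] W) (z : L) :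
    ∑ i, (β ⁅z, e i⁆ (B.dualBasis hB e i) + β (e i) ⁅z, B.dualBasis hB e i⁆) = 0 := by
  set f := B.dualBasis hB e with hf
  have hef : ∀ i j, B (e i) (f j) = if i = j then 1 else 0 := fun i j => by
    rw [hf, LinearMap.BilinForm.apply_dualBasis_right hB hsymm]
  have he : ∀ x : I, x = ∑ j, B x (f j) • e j := fun x => by
    conv_lhs => rw [← e.sum_repr x]
    refine Finset.sum_congr rfl fun j _ => ?_
    congr 1
    conv_rhs => rw [← e.sum_repr x]
    simp only [map_sum, map_smul, LinearMap.sum_apply, LinearMap.smul_apply, hef]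
    simp
  have hf' : ∀ x : I, x = ∑ j, B (e j) x • f j := fun x => by
    conv_lhs => rw [← f.sum_repr x]
    refine Finset.sum_congr rfl fun j _ => ?_
    congr 1
    conv_rhs => rw [← f.sum_repr x]
    simp only [map_sum, map_smul, hef]
    simp
  have h1 : ∀ i, β ⁅z, e i⁆ (f i) = ∑ j, B ⁅z, e i⁆ (f j) • β (e j) (f i) := fun i => by
    conv_lhs => rw [he ⁅z, e i⁆]
    simp
  have h2 : ∀ i, β (e i) ⁅z, f i⁆ = ∑ j, B (e j) ⁅z, f i⁆ • β (e i) (f j) := fun i => by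
    conv_lhs => rw [hf' ⁅z, f i⁆]
    simp
  simp_rw [Finset.sum_add_distrib, h1, h2]
  -- With the indices of one sum exchanged, both sums run over the same values of `β`, with
  -- coefficients opposite by invariance.
  rw [Finset.sum_comm, ← Finset.sum_add_distrib]
  refine Finset.sum_eq_zero fun j _ => ?_
  rw [← Finset.sum_add_distrib]
  refine Finset.sum_eq_zero fun i _ => ?_
  rw [hinv, neg_smul, neg_add_cancel]

variable {M : Type*} [AddCommGroup M] [Module K M] [LieRingModule L M] [LieModule K L M]

/-- A one-cocycle of a Lie algebra with values in a module. -/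
def IsLieOneCocycle (φ : L →ₗ[K] M) : Prop :=
  ∀ u v, φ ⁅u, v⁆ = ⁅u, φ v⁆ - ⁅v, φ u⁆

section Simple

variable [FiniteDimensional K M]

/-- An ideal with nondegenerate trace form on an irreducible module forces every cocycle to be
a coboundary. -/
theorem IsLieOneCocycle.exists_of_traceForm_nondegenerate [FiniteDimensional K L] [CharZero K]
    [IsIrreducible K L M]
    (I : LieIdeal K L) (hI : I ≠ ⊥) (hB : (traceForm K I M).Nondegenerate)
    {φ : L →ₗ[K] M} (hφ : IsLieOneCocycle φ) : ∃ m : M, ∀ u, φ u = ⁅u, m⁆ := by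
  classical
  let e := Module.finBasis K I
  let f := (traceForm K I M).dualBasis hB e
  have hsymm : (traceForm K I M).IsSymm := ⟨traceForm_comm K I M⟩
  have hinv : ∀ (z : L) (x y : I), traceForm K I M ⁅z, x⁆ y = - traceForm K I M x ⁅z, y⁆ := by
    intro z x y
    have h := traceForm_apply_lie_apply' K L M z (x : L) (y : L)
    exact h
  have key := fun (W : Type _) (_ : AddCommGroup W) (_ : Module K W) β z =>
    I.sum_lie_dualBasis_add (W := W) (traceForm K I M) hB hsymm hinv e β z
  let ρ : I →ₗ[K] End K M := (toEnd K I M : I →ₗ[K] End K M)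
  -- The Casimir operator of `I` on `M`. It commutes with `L` and has trace `dim I ≠ 0`, so
  -- irreducibility makes it invertible.
  let C : End K M := ∑ i, ρ (e i) * ρ (f i)
  have hC : ∀ m, C m = ∑ i, ⁅(e i : L), ⁅(f i : L), m⁆⁆ := fun m => by
    simp only [C, LinearMap.sum_apply]
    rfl
  have hcomm : ∀ (z : L) m, C ⁅z, m⁆ = ⁅z, C m⁆ := by
    intro z m
    let β : I →ₗ[K] I →ₗ[K] M := LinearMap.mk₂ K (fun x y => ⁅(x : L), ⁅(y : L), m⁆⁆)
      (by simp) (by simp) (by simp) (by simp)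
    have h := key M _ _ β z
    simp only [β, LinearMap.mk₂_apply, LieSubmodule.coe_bracket] at h
    rw [hC, hC, lie_sum, ← sub_eq_zero, ← neg_eq_zero, ← h, ← Finset.sum_sub_distrib,
      ← Finset.sum_neg_distrib]
    refine Finset.sum_congr rfl fun i _ => ?_
    simp only [lie_lie, lie_sub]
    show _ = ⁅z, ⁅(e i : L), ⁅(f i : L), m⁆⁆⁆ - ⁅(e i : L), ⁅z, ⁅(f i : L), m⁆⁆⁆ +
      (⁅(e i : L), ⁅z, ⁅(f i : L), m⁆⁆⁆ - ⁅(e i : L), ⁅(f i : L), ⁅z, m⁆⁆⁆)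
    abel
  -- Invariance of the canonical element, applied to `⁅x, φ y⁆`, and the cocycle identity give `C (φ
  -- z) = ⁅z, m₀⁆`. The required vector is therefore `C⁻¹ m₀`.
  let m₀ : M := ∑ i, ⁅(e i : L), φ (f i : L)⁆
  have hm₀ : ∀ z, C (φ z) = ⁅z, m₀⁆ := by
    intro z
    let β : I →ₗ[K] I →ₗ[K] M := LinearMap.mk₂ K (fun x y => ⁅(x : L), φ (y : L)⁆)
      (by simp) (by simp) (by simp) (by simp)
    have h := key M _ _ β z
    simp only [β, LinearMap.mk₂_apply, LieSubmodule.coe_bracket] at h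
    rw [hC, lie_sum, ← sub_eq_zero, ← neg_eq_zero, ← h, ← Finset.sum_sub_distrib,
      ← Finset.sum_neg_distrib]
    refine Finset.sum_congr rfl fun i _ => ?_
    show _ = ⁅⁅z, (e i : L)⁆, φ (f i : L)⁆ + ⁅(e i : L), φ ⁅z, (f i : L)⁆⁆
    rw [hφ z, lie_lie, lie_sub]
    abel
  have htr : LinearMap.trace K M C ≠ 0 := by
    have : LinearMap.trace K M C = finrank K I := by
      have h1 : ∀ i, LinearMap.trace K M (ρ (e i) * ρ (f i)) = 1 := fun i => by
        have h := LinearMap.BilinForm.apply_dualBasis_right hB hsymm e i i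
        rw [if_pos rfl] at h
        exact h
      simp only [C, map_sum, h1]
      simp
    rw [this]
    have : Nontrivial I := (LieSubmodule.nontrivial_iff_ne_bot K L L).mpr hI
    exact_mod_cast (finrank_pos (R := K) (M := I)).ne'
  let N : LieSubmodule K L M :=
    { LinearMap.ker C with
      lie_mem := fun {z m} hm => by
        have hm' : C m = 0 := hm
        show C ⁅z, m⁆ = 0
        rw [hcomm, hm', lie_zero] }
  have hN : N = ⊥ := by
    refine (IsSimpleOrder.eq_bot_or_eq_top N).resolve_right fun hN => htr ?_
    have : C = 0 := LinearMap.ext fun m => by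
      have : m ∈ N := hN ▸ LieSubmodule.mem_top m
      exact this
    rw [this, map_zero]
  have hinj : Function.Injective C := by
    rw [injective_iff_map_eq_zero]
    intro m hm
    have : m ∈ N := hm
    rwa [hN, LieSubmodule.mem_bot] at this
  obtain ⟨m, hm⟩ := (LinearMap.injective_iff_surjective.mp hinj) m₀
  exact ⟨m, fun u => hinj (by rw [hm₀, hcomm, hm])⟩

/-- A simple ideal acting nontrivially on an irreducible module has nondegenerate trace form. -/
theorem LieIdeal.traceForm_nondegenerate_of_isAtom [CharZero K] [IsSemisimple K L]
    [IsIrreducible K L M] (I : LieIdeal K L) (hI : IsAtom I) (hM : ¬ I ≤ LieModule.ker K L M) :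
    (traceForm K I M).Nondegenerate := by
  -- The radical of the trace form on `I` is an ideal of `L`, hence `⊥` or all of the atom `I`.
  let R : LieIdeal K L :=
    { carrier := {x | x ∈ I ∧ ∀ y ∈ I, traceForm K L M x y = 0}
      add_mem' := fun {a b} ha hb => ⟨add_mem ha.1 hb.1, fun y hy => by
        rw [map_add, LinearMap.add_apply, ha.2 y hy, hb.2 y hy, add_zero]⟩
      zero_mem' := ⟨zero_mem _, fun y _ => by simp⟩
      smul_mem' := fun c x hx => ⟨I.toSubmodule.smul_mem c hx.1, fun y hy => by
        rw [map_smul, LinearMap.smul_apply, hx.2 y hy, smul_zero]⟩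
      lie_mem := fun {z x} hx => ⟨I.lie_mem hx.1, fun y hy => by
        rw [traceForm_apply_lie_apply', hx.2 _ (I.lie_mem hy), neg_zero]⟩ }
  have hRI : R ≤ I := fun x hx => hx.1
  refine (traceForm_isSymm K I M).isRefl.nondegenerate_iff_separatingLeft.mpr ?_
  rcases hI.le_iff.mp hRI with hR | hR
  · intro x hx
    have : (x : L) ∈ R := ⟨x.2, fun y hy => hx ⟨y, hy⟩⟩
    rw [hR, LieSubmodule.mem_bot] at this
    exact Subtype.ext this
  · exfalso
    have h0 : traceForm K I M = 0 := by
      refine LinearMap.ext fun x => LinearMap.ext fun y => ?_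
      have hx : (x : L) ∈ R := hR.symm ▸ x.2
      exact hx.2 y y.2
    -- If the form vanishes on `I`, then `[I, I]`, which is `I` by simplicity, acts nilpotently, so
    -- `I` fixes a nonzero vector.
    have hnil := isNilpotent_derivedSeries_of_traceForm_eq_zero h0
    have hs : IsSimple K I := IsSemisimple.isSimple_of_isAtom I hI
    have hnilI : ∀ x : I, _root_.IsNilpotent (toEnd K I M x) := by
      have htop : derivedSeries K I 1 = ⊤ := by
        refine (hs.eq_bot_or_eq_top _).resolve_left fun hbot => hs.non_abelian ?_
        rw [derivedSeries_def, derivedSeriesOfIdeal_succ, derivedSeriesOfIdeal_zero] at hbot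
        rw [LieSubmodule.lie_eq_bot_iff] at hbot
        exact ⟨fun x y => hbot x (LieSubmodule.mem_top _) y (LieSubmodule.mem_top _)⟩
      intro x
      have hx : x ∈ derivedSeries K I 1 := htop ▸ LieSubmodule.mem_top x
      exact (isNilpotent_iff_forall' (R := K)).mp hnil ⟨x, hx⟩
    have hnilM : LieModule.IsNilpotent I M := (isNilpotent_iff_forall' (R := K)).mpr hnilI
    have : Nontrivial M := nontrivial_of_isIrreducible K L M
    have hmax := nontrivial_max_triv_of_isNilpotent K I M
    -- The `I`-invariants are stable under `L` because `I` is an ideal. Being nonzero they are all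
    -- of `M`, against `hM`.
    let T : LieSubmodule K L M :=
      { (maxTrivSubmodule K I M).toSubmodule with
        lie_mem := fun {z m} hm => by
          have hm' : ∀ x : I, ⁅(x : L), m⁆ = 0 := hm
          show ∀ x : I, ⁅(x : L), ⁅z, m⁆⁆ = 0
          intro x
          rw [leibniz_lie, hm' x, lie_zero, add_zero]
          have h := hm' ⟨⁅(x : L), z⁆, lie_mem_left K L I _ _ x.2⟩
          exact h }
    rcases IsSimpleOrder.eq_bot_or_eq_top T with hT | hT
    · obtain ⟨m, hm⟩ := exists_ne (0 : maxTrivSubmodule K I M)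
      have : (m : M) ∈ T := m.2
      rw [hT, LieSubmodule.mem_bot] at this
      exact hm (Subtype.ext this)
    · refine hM fun x hx => ?_
      rw [LieModule.mem_ker]
      intro m
      have : m ∈ T := hT ▸ LieSubmodule.mem_top m
      have hm' : ∀ x : I, ⁅(x : L), m⁆ = 0 := this
      exact hm' ⟨x, hx⟩

end Simple

/-- Each atom is non-abelian, hence equal to its own bracket, and the atoms span. Perfectness is
what kills cocycles with values in a trivial module. -/
theorem LieAlgebra.IsSemisimple.lie_top_top [IsSemisimple K L] :
    ⁅(⊤ : LieIdeal K L), (⊤ : LieIdeal K L)⁆ = ⊤ := by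
  rw [eq_top_iff, ← IsSemisimple.sSup_atoms_eq_top (R := K) (L := L)]
  refine sSup_le fun I hI => ?_
  have hI : IsAtom I := hI
  rw [IsSemisimple.sSup_atoms_eq_top (R := K) (L := L)]
  refine le_trans ?_ (LieSubmodule.mono_lie (le_top (a := I)) (le_top (a := I)))
  refine ((hI.le_iff.mp (LieSubmodule.lie_le_left I I)).resolve_left fun h => ?_).ge
  refine IsSemisimple.non_abelian_of_isAtom I hI ⟨fun x y => Subtype.ext ?_⟩
  exact (LieSubmodule.lie_eq_bot_iff _ _).mp h x x.2 y y.2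

/-- Whitehead's first lemma for irreducible modules. -/
theorem IsLieOneCocycle.exists_of_isIrreducible [CharZero K] [IsSemisimple K L]
    [FiniteDimensional K M] [FiniteDimensional K L] [IsIrreducible K L M]
    {φ : L →ₗ[K] M} (hφ : IsLieOneCocycle φ) : ∃ m : M, ∀ u, φ u = ⁅u, m⁆ := by
  by_cases h : ∀ I : LieIdeal K L, IsAtom I → I ≤ LieModule.ker K L M
  · have htriv : ∀ (u : L) (m : M), ⁅u, m⁆ = 0 := by
      have : (⊤ : LieIdeal K L) ≤ LieModule.ker K L M := by
        rw [← IsSemisimple.sSup_atoms_eq_top (R := K) (L := L)]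
        exact sSup_le h
      intro u m
      exact (LieModule.mem_ker K L M u).mp (this (LieSubmodule.mem_top u)) m
    refine ⟨0, fun u => ?_⟩
    rw [lie_zero]
    have hu : u ∈ (⁅(⊤ : LieIdeal K L), (⊤ : LieIdeal K L)⁆).toSubmodule := by
      rw [IsSemisimple.lie_top_top]; exact LieSubmodule.mem_top u
    rw [LieSubmodule.lieIdeal_oper_eq_linear_span'] at hu
    induction hu using Submodule.span_induction with
    | mem x hx =>
      obtain ⟨a, -, b, -, rfl⟩ := hx
      rw [hφ, htriv, htriv, sub_zero]
    | zero => simp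
    | add x y _ _ hx hy => rw [map_add, hx, hy, add_zero]
    | smul c x _ hx => rw [map_smul, hx, smul_zero]
  · push Not at h
    obtain ⟨I, hI, hM⟩ := h
    exact hφ.exists_of_traceForm_nondegenerate I hI.1 (I.traceForm_nondegenerate_of_isAtom hI hM)

/-- **Whitehead's first lemma**: every one-cocycle of a finite-dimensional semisimple Lie algebra of
characteristic zero with values in a finite-dimensional module is a coboundary. -/
theorem IsLieOneCocycle.exists_eq_lie [CharZero K] [IsSemisimple K L]
    [FiniteDimensional K M] [FiniteDimensional K L]
    {φ : L →ₗ[K] M} (hφ : IsLieOneCocycle φ) : ∃ m : M, ∀ u, φ u = ⁅u, m⁆ := by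
  obtain ⟨n, hn⟩ : ∃ n, finrank K M = n := ⟨_, rfl⟩
  induction n using Nat.strong_induction_on generalizing M with
  | _ n ih =>
  rcases subsingleton_or_nontrivial M with hM | hM
  · exact ⟨0, fun u => Subsingleton.elim _ _⟩
  by_cases hirr : ∀ N : LieSubmodule K L M, N ≠ ⊥ → N = ⊤
  · have : IsIrreducible K L M := IsIrreducible.mk hirr
    exact hφ.exists_of_isIrreducible
  push Not at hirr
  obtain ⟨N, hN0, hN1⟩ := hirr
  have hN1' : N.toSubmodule ≠ ⊤ := fun h => hN1 (by simpa using h)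
  have hsum : finrank K (M ⧸ N) + finrank K N = finrank K M :=
    Submodule.finrank_quotient_add_finrank N.toSubmodule
  have hlt : finrank K N < finrank K M := Submodule.finrank_lt hN1'
  have hpos : 0 < finrank K N := by
    have : Nontrivial N := (LieSubmodule.nontrivial_iff_ne_bot K L M).mpr hN0
    exact finrank_pos
  -- In the reducible case, the cocycle is first solved modulo `N`. After subtracting the coboundary
  -- of a lift, what remains is a cocycle with values in `N`.
  let p : M →ₗ⁅K,L⁆ M ⧸ N := LieSubmodule.Quotient.mk' N
  have hψ : IsLieOneCocycle ((p : M →ₗ[K] M ⧸ N) ∘ₗ φ) := fun u v => by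
    simp [hφ u v]
  obtain ⟨mq, hmq⟩ := ih (finrank K (M ⧸ N)) (by omega) hψ rfl
  obtain ⟨m, rfl⟩ := LieSubmodule.Quotient.surjective_mk' N mq
  have hmem : ∀ u, φ u - ⁅u, m⁆ ∈ N := fun u => by
    rw [← LieSubmodule.Quotient.mk_eq_zero (N := N)]
    have := hmq u
    simp only [LinearMap.comp_apply] at this
    show p (φ u - ⁅u, m⁆) = 0
    rw [map_sub, LieModuleHom.map_lie, sub_eq_zero]
    exact this
  let δ : L →ₗ[K] M := (toEnd K L M : L →ₗ[K] End K M).flip m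
  let χ : L →ₗ[K] N := (φ - δ).codRestrict N.toSubmodule fun u => hmem u
  have hχ' : ∀ u, (χ u : M) = φ u - ⁅u, m⁆ := fun u => rfl
  have hχ : IsLieOneCocycle χ := fun u v => by
    apply Subtype.ext
    simp only [LieSubmodule.coe_sub, LieSubmodule.coe_bracket, hχ', hφ u v, lie_sub, lie_lie]
    abel
  obtain ⟨m', hm'⟩ := ih (finrank K N) (by omega) hχ rfl
  refine ⟨m + m', fun u => ?_⟩
  have := congrArg (Subtype.val) (hm' u)
  rw [hχ', LieSubmodule.coe_bracket] at this
  rw [lie_add, ← this]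
  abel

end Whitehead

/-! ### Polynomials on the dual as a Lie module -/

namespace CLPoisson

theorem derivation_sum_apply {R A M κ : Type*} [CommSemiring R] [CommSemiring A] [AddCommMonoid M]
    [Algebra R A] [Module A M] [Module R M] (s : Finset κ) (D : κ → Derivation R A M) (a : A) :
    (∑ k ∈ s, D k) a = ∑ k ∈ s, D k a := by
  have h := congrFun (map_sum (Derivation.coeFnAddMonoidHom (R := R) (A := A) (M := M)) D s) a
  rwa [Finset.sum_apply] at h

/-- The commutator of two derivations is a derivation, and this one vanishes on the variables. -/
theorem pderiv_pderiv_comm {R σ : Type*} [CommRing R] (i j : σ) (p : MvPolynomial σ R) :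
    MvPolynomial.pderiv i (MvPolynomial.pderiv j p)
      = MvPolynomial.pderiv j (MvPolynomial.pderiv i p) := by
  classical
  have h : ⁅MvPolynomial.pderiv (R := R) i, MvPolynomial.pderiv (R := R) j⁆ = 0 := by
    refine MvPolynomial.derivation_ext fun k => ?_
    rw [Derivation.commutator_apply]
    simp only [MvPolynomial.pderiv_X, Pi.single_apply]
    split_ifs <;> simp
  have h' := congrArg (fun D => D p) h
  rw [Derivation.commutator_apply] at h'
  exact sub_eq_zero.mp h'

section LinearPoisson

open MvPolynomial

variable {K L : Type*} [Field K] [LieRing L] [LieAlgebra K L] {ι : Type*}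

/-- An element of a Lie algebra as a linear polynomial on the dual. -/
noncomputable def linPoly (b : Module.Basis ι K L) : L →ₗ[K] MvPolynomial ι K :=
  b.constr K fun i => X i

/-- The Hamiltonian derivation of an element of a Lie algebra on polynomials on the dual. -/
noncomputable def lieDerivation (b : Module.Basis ι K L) (u : L) :
    Derivation K (MvPolynomial ι K) (MvPolynomial ι K) :=
  mkDerivation K fun i => linPoly b ⁅u, b i⁆

variable (b : Module.Basis ι K L)

theorem lieDerivation_X (u : L) (i : ι) : lieDerivation b u (X i) = linPoly b ⁅u, b i⁆ :=
  mkDerivation_X _ _ _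

theorem lieDerivation_add (u v : L) :
    lieDerivation b (u + v) = lieDerivation b u + lieDerivation b v := by
  refine MvPolynomial.derivation_ext fun i => ?_
  simp [lieDerivation_X]

theorem lieDerivation_smul (c : K) (u : L) :
    lieDerivation b (c • u) = c • lieDerivation b u := by
  refine MvPolynomial.derivation_ext fun i => ?_
  simp [lieDerivation_X]

variable [Fintype ι]

theorem linPoly_apply (w : L) : linPoly b w = ∑ k, b.repr w k • X k := by
  rw [linPoly, Module.Basis.constr_apply_fintype]
  rfl

theorem lieDerivation_linPoly (u w : L) :
    lieDerivation b u (linPoly b w) = linPoly b ⁅u, w⁆ := by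
  conv_rhs => rw [← b.sum_repr w]
  rw [linPoly_apply, map_sum, lie_sum, map_sum]
  refine Finset.sum_congr rfl fun k _ => ?_
  rw [Derivation.map_smul, lieDerivation_X, lie_smul, map_smul]

/-- Both sides are derivations, so coordinates suffice; there the claim is the Jacobi identity of
`L`. -/
theorem lieDerivation_lie (u v : L) :
    lieDerivation b ⁅u, v⁆ = ⁅lieDerivation b u, lieDerivation b v⁆ := by
  refine MvPolynomial.derivation_ext fun i => ?_
  rw [Derivation.commutator_apply]
  simp only [lieDerivation_X, lieDerivation_linPoly, lie_lie, map_sub]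

theorem lieDerivation_apply (u : L) (p : MvPolynomial ι K) :
    lieDerivation b u p = ∑ l, linPoly b ⁅u, b l⁆ * pderiv l p := by
  classical
  have : lieDerivation b u = ∑ l, linPoly b ⁅u, b l⁆ • pderiv l := by
    refine MvPolynomial.derivation_ext fun i => ?_
    rw [derivation_sum_apply]
    simp [lieDerivation_X, pderiv_X, Pi.single_apply]
  rw [this, derivation_sum_apply]
  simp

theorem linPoly_isHomogeneous (w : L) : (linPoly b w).IsHomogeneous 1 := by
  rw [linPoly_apply]
  refine IsHomogeneous.sum _ _ _ fun k _ => ?_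
  exact (homogeneousSubmodule ι K 1).smul_mem _ (isHomogeneous_X K k)

theorem lieDerivation_isHomogeneous (u : L) {p : MvPolynomial ι K} {d : ℕ}
    (hp : p.IsHomogeneous (d + 1)) : (lieDerivation b u p).IsHomogeneous (d + 1) := by
  rw [lieDerivation_apply]
  refine IsHomogeneous.sum _ _ _ fun l _ => ?_
  rw [add_comm d 1]
  exact (linPoly_isHomogeneous b _).mul hp.pderiv

/-- Whitehead's lemma needs finite-dimensional coefficients, which is why one degree is treated at a
time. -/
theorem finiteDimensional_homogeneousSubmodule (d : ℕ) :
    FiniteDimensional K (homogeneousSubmodule ι K d) := by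
  have h : homogeneousSubmodule ι K d ≤ restrictTotalDegree ι K d := fun p hp =>
    (mem_restrictTotalDegree _ _ _).mpr ((mem_homogeneousSubmodule _ _).mp hp).totalDegree_le
  exact Submodule.finiteDimensional_of_le h

/-- Homogeneous polynomials of positive degree on the dual of a Lie algebra, as a Lie module. -/
@[reducible] noncomputable def homogeneousLieRingModule (d : ℕ) :
    LieRingModule L (homogeneousSubmodule ι K (d + 1)) where
  bracket u p := ⟨lieDerivation b u p, lieDerivation_isHomogeneous b u p.2⟩
  add_lie u v p := Subtype.ext (by simp [lieDerivation_add])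
  lie_add u p q := Subtype.ext (by simp)
  leibniz_lie u v p := Subtype.ext (by simp [lieDerivation_lie, Derivation.commutator_apply])

/-- A homogeneous polynomial vector field on the dual of a semisimple Lie algebra which preserves the
Lie–Poisson bivector is Hamiltonian. -/
theorem exists_hamiltonian_of_homogeneous [CharZero K] [LieAlgebra.IsSemisimple K L] {d : ℕ}
    (Z : ι → MvPolynomial ι K) (hZ : ∀ i, (Z i).IsHomogeneous (d + 1))
    (hcocycle : ∀ i j, ∑ l, Z l * pderiv l (linPoly b ⁅b i, b j⁆)
      = lieDerivation b (b i) (Z j) - lieDerivation b (b j) (Z i)) :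
    ∃ h : MvPolynomial ι K, ∀ i, Z i = lieDerivation b (b i) h := by
  classical
  let _ := homogeneousLieRingModule b d
  have : LieModule K L (homogeneousSubmodule ι K (d + 1)) :=
    { smul_lie := fun c u p => Subtype.ext (by
        show lieDerivation b (c • u) p = c • lieDerivation b u p
        rw [lieDerivation_smul]; rfl)
      lie_smul := fun c u p => Subtype.ext (by
        show lieDerivation b u (c • (p : MvPolynomial ι K)) = c • lieDerivation b u p
        rw [Derivation.map_smul]) }
  have := finiteDimensional_homogeneousSubmodule (K := K) (ι := ι) (d + 1)
  have : FiniteDimensional K L := b.finiteDimensional_of_finite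
  -- `φ w` is the derivative along `Z` of the linear function `w`. Both sides of the cocycle
  -- identity are bilinear, so it need only be checked on basis vectors, where it is `hcocycle`.
  let φ : L →ₗ[K] homogeneousSubmodule ι K (d + 1) := b.constr K fun i => ⟨Z i, hZ i⟩
  have hφb : ∀ i, φ (b i) = ⟨Z i, hZ i⟩ := fun i => b.constr_basis K _ i
  have hφ : IsLieOneCocycle φ := by
    have hsmul : ∀ (c : K) (u : L) (p : homogeneousSubmodule ι K (d + 1)),
        ⁅u, c • p⁆ = c • ⁅u, p⁆ := fun c u p => lie_smul c u p
    let β₁ : L →ₗ[K] L →ₗ[K] homogeneousSubmodule ι K (d + 1) :=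
      LinearMap.mk₂ K (fun u v => φ ⁅u, v⁆) (by simp) (by simp) (by simp) (by simp)
    let β₂ : L →ₗ[K] L →ₗ[K] homogeneousSubmodule ι K (d + 1) :=
      LinearMap.mk₂ K (fun u v => ⁅u, φ v⁆ - ⁅v, φ u⁆)
        (fun u u' v => by simp only [add_lie, map_add, lie_add]; abel)
        (fun c u v => by rw [map_smul, smul_lie, hsmul, smul_sub])
        (fun u v v' => by simp only [add_lie, map_add, lie_add]; abel)
        (fun c u v => by rw [map_smul, smul_lie, hsmul, smul_sub])
    have h : β₁ = β₂ := by
      refine b.ext fun i => b.ext fun j => Subtype.ext ?_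
      have hφl : ∀ w, (φ w : MvPolynomial ι K) = ∑ l, Z l * pderiv l (linPoly b w) := fun w => by
        have h2 : φ w = ∑ l, b.repr w l • φ (b l) := by
          conv_lhs => rw [← b.sum_repr w, map_sum]
          simp only [map_smul]
        rw [h2, Submodule.coe_sum]
        refine Finset.sum_congr rfl fun l _ => ?_
        rw [hφb, linPoly_apply]
        simp [pderiv_X, Pi.single_apply, Algebra.smul_def, mul_comm]
      show (φ ⁅b i, b j⁆ : MvPolynomial ι K)
        = lieDerivation b (b i) (φ (b j)) - lieDerivation b (b j) (φ (b i))
      rw [hφl, hφb, hφb, hcocycle]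
    intro u v
    exact congrArg (fun β : L →ₗ[K] L →ₗ[K] homogeneousSubmodule ι K (d + 1) => β u v) h
  obtain ⟨m, hm⟩ := hφ.exists_eq_lie
  refine ⟨m, fun i => ?_⟩
  have h := congrArg Subtype.val (hm (b i))
  rw [hφb] at h
  exact h

end LinearPoisson

/-! ### Compatible bivectors -/

section Compatible

open MvPolynomial

/-- If `P` and `Q` are compatible bivectors and `P(q)` preserves `Q`, then `Q(q)` preserves `P`. -/
theorem ham_preserves_of_compatible {R ι : Type*} [CommRing R] [Fintype ι]
    (P Q : ι → ι → MvPolynomial ι R) (q : MvPolynomial ι R)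
    (hP : ∀ i j, P i j = -P j i) (hQ : ∀ i j, Q i j = -Q j i)
    (hcomp : ∀ i j k, ∑ l, (Q i l * pderiv l (P j k) + Q j l * pderiv l (P k i)
      + Q k l * pderiv l (P i j) + P i l * pderiv l (Q j k) + P j l * pderiv l (Q k i)
      + P k l * pderiv l (Q i j)) = 0)
    (hpres : ∀ i j, ∑ l, ((∑ m, P l m * pderiv m q) * pderiv l (Q i j)
      - Q i l * pderiv l (∑ m, P j m * pderiv m q)
      + Q j l * pderiv l (∑ m, P i m * pderiv m q)) = 0) (i j : ι) :
    ∑ l, ((∑ m, Q l m * pderiv m q) * pderiv l (P i j)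
      - P i l * pderiv l (∑ m, Q j m * pderiv m q)
      + P j l * pderiv l (∑ m, Q i m * pderiv m q)) = 0 := by
  -- The compatibility identity contracted with `dq`. Up to sign it is `L_{P(q)} Q + L_{Q(q)} P`,
  -- apart from second derivatives of `q`.
  have hA : ∑ l, ∑ k, pderiv k q * (Q i l * pderiv l (P j k) + Q j l * pderiv l (P k i)
      + Q k l * pderiv l (P i j) + P i l * pderiv l (Q j k) + P j l * pderiv l (Q k i)
      + P k l * pderiv l (Q i j)) = 0 := by
    rw [Finset.sum_comm]
    refine Finset.sum_eq_zero fun k _ => ?_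
    rw [← Finset.mul_sum, hcomp, mul_zero]
  have hB := hpres i j
  -- The second derivatives of `q` are symmetric and meet a factor antisymmetric in `l` and `k`.
  have hS : ∑ l, ∑ k, pderiv l (pderiv k q)
      * (P i l * Q j k - P j l * Q i k + Q i l * P j k - Q j l * P i k) = 0 := by
    have h1 : ∑ l, ∑ k, pderiv l (pderiv k q) * (P i l * Q j k - P j l * Q i k)
        = ∑ l, ∑ k, pderiv l (pderiv k q) * (Q j l * P i k - Q i l * P j k) := by
      rw [Finset.sum_comm]
      refine Finset.sum_congr rfl fun l _ => Finset.sum_congr rfl fun k _ => ?_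
      rw [pderiv_pderiv_comm]
      ring
    calc _ = ∑ l, ∑ k, pderiv l (pderiv k q) * (P i l * Q j k - P j l * Q i k)
        - ∑ l, ∑ k, pderiv l (pderiv k q) * (Q j l * P i k - Q i l * P j k) := by
          simp_rw [← Finset.sum_sub_distrib]
          refine Finset.sum_congr rfl fun l _ => Finset.sum_congr rfl fun k _ => ?_
          ring
      _ = 0 := by rw [h1, sub_self]
  simp only [map_sum, pderiv_mul, Finset.sum_mul, Finset.mul_sum, ← Finset.sum_sub_distrib,
    ← Finset.sum_add_distrib] at hB ⊢
  have h0 := congrArg₂ (· - ·) (congrArg₂ (· - ·) (congrArg Neg.neg hS) hA) hB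
  simp only [neg_zero, sub_zero] at h0
  refine Eq.trans ?_ h0
  simp only [← Finset.sum_sub_distrib, ← Finset.sum_neg_distrib]
  refine Finset.sum_congr rfl fun l _ => Finset.sum_congr rfl fun k _ => ?_
  have e1 : pderiv l (P k i) = -pderiv l (P i k) := by rw [hP k i, map_neg]
  have e2 : pderiv l (Q k i) = -pderiv l (Q i k) := by rw [hQ k i, map_neg]
  rw [e1, e2, hP k l, hQ k l]
  ring

end Compatible

end CLPoisson

namespace CLPoisson

/-! ### Calculus of partial derivatives on `𝔰*` and `𝔤*` -/

section PartialDerivatives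

variable {𝕜 : Type*} [RCLike 𝕜] {ι : Type*}

theorem pd_zero [DecidableEq ι] (i : ι) (x : ι → 𝕜) : pd i (fun _ => (0 : 𝕜)) x = 0 := by
  simp [pd]

theorem pd_coord [DecidableEq ι] (i j : ι) (x : ι → 𝕜) :
    pd i (fun y : ι → 𝕜 => y j) x = if j = i then 1 else 0 := by
  rw [pd, (hasFDerivAt_apply (𝕜 := 𝕜) j x).fderiv]
  simp [Pi.single_apply]

variable [Fintype ι]

theorem differentiable_of_contDiff {f : (ι → 𝕜) → 𝕜} (hf : ContDiff 𝕜 ∞ f) :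
    Differentiable 𝕜 f :=
  hf.differentiable (by simp)

theorem differentiable_eval (p : MvPolynomial ι 𝕜) :
    Differentiable 𝕜 fun y : ι → 𝕜 => MvPolynomial.eval y p := by
  induction p using MvPolynomial.induction_on with
  | C a => simp
  | add p q hp hq => simpa only [map_add] using hp.fun_add hq
  | mul_X p j hp =>
    simp only [map_mul, MvPolynomial.eval_X]
    fun_prop

/-- The source of the rules for `F`, `x₀ F` and `x₀ᵐ F`. At `m = 0` the factor `m` cancels the
effect of the truncated exponent `m - 1`. -/
theorem hasFDerivAt_pow_mul {F : (ι → 𝕜) → 𝕜} (m : ℕ) (x : ι ⊕ Unit → 𝕜)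
    (hF : DifferentiableAt 𝕜 F fun j => x (Sum.inl j)) :
    HasFDerivAt (fun y : ι ⊕ Unit → 𝕜 => y (Sum.inr ()) ^ m * F fun j => y (Sum.inl j))
      (x (Sum.inr ()) ^ m • (fderiv 𝕜 F fun j => x (Sum.inl j)).comp
          (ContinuousLinearMap.pi fun j => ContinuousLinearMap.proj (Sum.inl j))
        + (F fun j => x (Sum.inl j)) • (((m : 𝕜) * x (Sum.inr ()) ^ (m - 1)) •
          (ContinuousLinearMap.proj (Sum.inr ()) : (ι ⊕ Unit → 𝕜) →L[𝕜] 𝕜))) x := by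
  have h0 : HasFDerivAt (fun y : ι ⊕ Unit → 𝕜 => fun j => y (Sum.inl j))
      (ContinuousLinearMap.pi fun j => ContinuousLinearMap.proj (Sum.inl j) :
        (ι ⊕ Unit → 𝕜) →L[𝕜] ι → 𝕜) x :=
    (ContinuousLinearMap.pi fun j => ContinuousLinearMap.proj (Sum.inl j) :
        (ι ⊕ Unit → 𝕜) →L[𝕜] ι → 𝕜).hasFDerivAt
  have h1 := HasFDerivAt.comp x (g := F) hF.hasFDerivAt h0
  have h2 := (hasFDerivAt_apply (𝕜 := 𝕜) (Sum.inr () : ι ⊕ Unit) x).pow m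
  refine (h2.mul h1).congr_fderiv ?_
  ext v
  simp [mul_assoc]

theorem differentiableAt_comp_inl {F : (ι → 𝕜) → 𝕜} (x : ι ⊕ Unit → 𝕜)
    (hF : DifferentiableAt 𝕜 F fun j => x (Sum.inl j)) :
    DifferentiableAt 𝕜 (fun y : ι ⊕ Unit → 𝕜 => F fun j => y (Sum.inl j)) x := by
  simpa using (hasFDerivAt_pow_mul 0 x hF).differentiableAt

theorem differentiableAt_mul_comp_inl {F : (ι → 𝕜) → 𝕜} (x : ι ⊕ Unit → 𝕜)
    (hF : DifferentiableAt 𝕜 F fun j => x (Sum.inl j)) :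
    DifferentiableAt 𝕜
      (fun y : ι ⊕ Unit → 𝕜 => y (Sum.inr ()) * F fun j => y (Sum.inl j)) x := by
  simpa using (hasFDerivAt_pow_mul 1 x hF).differentiableAt

variable [DecidableEq ι]

theorem pd_sum {κ : Type*} (s : Finset κ) (i : ι) {f : κ → (ι → 𝕜) → 𝕜} {x : ι → 𝕜}
    (hf : ∀ k ∈ s, DifferentiableAt 𝕜 (f k) x) :
    pd i (fun y => ∑ k ∈ s, f k y) x = ∑ k ∈ s, pd i (f k) x := by
  simp only [pd]
  rw [fderiv_fun_sum hf, sum_apply]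

theorem pd_add (i : ι) {f g : (ι → 𝕜) → 𝕜} {x : ι → 𝕜} (hf : DifferentiableAt 𝕜 f x)
    (hg : DifferentiableAt 𝕜 g x) : pd i (fun y => f y + g y) x = pd i f x + pd i g x := by
  simp only [pd]
  rw [fderiv_fun_add hf hg, add_apply]

theorem pd_sub (i : ι) {f g : (ι → 𝕜) → 𝕜} {x : ι → 𝕜} (hf : DifferentiableAt 𝕜 f x)
    (hg : DifferentiableAt 𝕜 g x) : pd i (fun y => f y - g y) x = pd i f x - pd i g x := by
  simp only [pd]
  rw [fderiv_fun_sub hf hg, sub_apply]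

theorem pd_mul (i : ι) {f g : (ι → 𝕜) → 𝕜} {x : ι → 𝕜} (hf : DifferentiableAt 𝕜 f x)
    (hg : DifferentiableAt 𝕜 g x) :
    pd i (fun y => f y * g y) x = f x * pd i g x + pd i f x * g x := by
  simp only [pd]
  rw [fderiv_fun_mul hf hg]
  simp [mul_comm]

theorem contDiff_pd {f : (ι → 𝕜) → 𝕜} (hf : ContDiff 𝕜 ∞ f) (i : ι) : ContDiff 𝕜 ∞ (pd i f) :=
  (hf.fderiv_right (m := ∞) le_rfl).clm_apply contDiff_const

theorem pd_comm {f : (ι → 𝕜) → 𝕜} (hf : ContDiff 𝕜 ∞ f) (i j : ι) (x : ι → 𝕜) :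
    pd i (pd j f) x = pd j (pd i f) x := by
  have hd : DifferentiableAt 𝕜 (fderiv 𝕜 f) x :=
    (hf.fderiv_right (m := ∞) le_rfl).differentiable (by simp) x
  have h : ∀ k l, pd k (pd l f) x = fderiv 𝕜 (fderiv 𝕜 f) x (Pi.single k 1) (Pi.single l 1) := by
    intro k l
    show fderiv 𝕜 (fun y => fderiv 𝕜 f y (Pi.single l 1)) x (Pi.single k 1) = _
    rw [fderiv_clm_apply hd (differentiableAt_const _)]
    simp
  rw [h, h]
  refine (hf.contDiffAt.isSymmSndFDerivAt ?_).eq _ _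
  rw [minSmoothness_of_isRCLikeNormedField]
  exact WithTop.coe_le_coe.mpr le_top

theorem pd_eval (p : MvPolynomial ι 𝕜) (i : ι) (x : ι → 𝕜) :
    pd i (fun y => MvPolynomial.eval y p) x = MvPolynomial.eval x (MvPolynomial.pderiv i p) := by
  induction p using MvPolynomial.induction_on with
  | C a => simp [pd]
  | add p q hp hq =>
    simp only [map_add]
    rw [pd_add i (differentiable_eval p x) (differentiable_eval q x), hp, hq]
  | mul_X p j hp =>
    simp only [map_mul, MvPolynomial.eval_X]
    rw [pd_mul i (differentiable_eval p x) (by fun_prop), hp]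
    rw [pd_coord]
    simp only [MvPolynomial.pderiv_mul, MvPolynomial.pderiv_X, map_add, map_mul,
      MvPolynomial.eval_X, Pi.single_apply, apply_ite (MvPolynomial.eval x), map_one, map_zero]
    ring

theorem pd_inl_pow_mul {F : (ι → 𝕜) → 𝕜} (m : ℕ) (x : ι ⊕ Unit → 𝕜)
    (hF : DifferentiableAt 𝕜 F fun j => x (Sum.inl j)) (i : ι) :
    pd (Sum.inl i) (fun y : ι ⊕ Unit → 𝕜 => y (Sum.inr ()) ^ m * F fun j => y (Sum.inl j)) x
      = x (Sum.inr ()) ^ m * pd i F fun j => x (Sum.inl j) := by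
  rw [pd, (hasFDerivAt_pow_mul m x hF).fderiv]
  have : (fun j => (Pi.single (Sum.inl i) 1 : ι ⊕ Unit → 𝕜) (Sum.inl j)) = Pi.single i 1 := by
    ext j
    simp [Pi.single_apply]
  simp [pd, this, ContinuousLinearMap.coe_pi']

theorem pd_inr_pow_mul {F : (ι → 𝕜) → 𝕜} (m : ℕ) (x : ι ⊕ Unit → 𝕜)
    (hF : DifferentiableAt 𝕜 F fun j => x (Sum.inl j)) :
    pd (Sum.inr ()) (fun y : ι ⊕ Unit → 𝕜 => y (Sum.inr ()) ^ m * F fun j => y (Sum.inl j)) x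
      = m * x (Sum.inr ()) ^ (m - 1) * F fun j => x (Sum.inl j) := by
  rw [pd, (hasFDerivAt_pow_mul m x hF).fderiv]
  have h : (fderiv 𝕜 F fun j => x (Sum.inl j)) (fun _ => 0) = 0 := map_zero _
  simp [ContinuousLinearMap.coe_pi', h, mul_comm]

theorem pd_inl_comp {F : (ι → 𝕜) → 𝕜} (x : ι ⊕ Unit → 𝕜)
    (hF : DifferentiableAt 𝕜 F fun j => x (Sum.inl j)) (i : ι) :
    pd (Sum.inl i) (fun y : ι ⊕ Unit → 𝕜 => F fun j => y (Sum.inl j)) x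
      = pd i F fun j => x (Sum.inl j) := by
  simpa using pd_inl_pow_mul 0 x hF i

theorem pd_inr_comp {F : (ι → 𝕜) → 𝕜} (x : ι ⊕ Unit → 𝕜)
    (hF : DifferentiableAt 𝕜 F fun j => x (Sum.inl j)) (u : Unit) :
    pd (Sum.inr u) (fun y : ι ⊕ Unit → 𝕜 => F fun j => y (Sum.inl j)) x = 0 := by
  simpa using pd_inr_pow_mul 0 x hF

theorem pd_inl_mul_comp {F : (ι → 𝕜) → 𝕜} (x : ι ⊕ Unit → 𝕜)
    (hF : DifferentiableAt 𝕜 F fun j => x (Sum.inl j)) (i : ι) :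
    pd (Sum.inl i) (fun y : ι ⊕ Unit → 𝕜 => y (Sum.inr ()) * F fun j => y (Sum.inl j)) x
      = x (Sum.inr ()) * pd i F fun j => x (Sum.inl j) := by
  simpa using pd_inl_pow_mul 1 x hF i

theorem pd_inr_mul_comp {F : (ι → 𝕜) → 𝕜} (x : ι ⊕ Unit → 𝕜)
    (hF : DifferentiableAt 𝕜 F fun j => x (Sum.inl j)) (u : Unit) :
    pd (Sum.inr u) (fun y : ι ⊕ Unit → 𝕜 => y (Sum.inr ()) * F fun j => y (Sum.inl j)) x
      = F fun j => x (Sum.inl j) := by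
  simpa using pd_inr_pow_mul 1 x hF

end PartialDerivatives

/-! ### Components of `π₁` and `π₂` -/

section Components

variable {𝕜 : Type*} [RCLike 𝕜] {𝔰 : Type*} [LieRing 𝔰] [LieAlgebra 𝕜 𝔰]
  {ι : Type*} [Fintype ι]

theorem liePoisson_eq_eval (b : Module.Basis ι 𝕜 𝔰) (x : ι → 𝕜) (i j : ι) :
    liePoisson b x i j = MvPolynomial.eval x (linPoly b ⁅b i, b j⁆) := by
  simp [liePoisson, linPoly_apply, MvPolynomial.smul_eval]

theorem liePoisson_skew (b : Module.Basis ι 𝕜 𝔰) (x : ι → 𝕜) (i j : ι) :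
    liePoisson b x i j = -liePoisson b x j i := by
  rw [liePoisson_eq_eval, liePoisson_eq_eval, ← lie_skew, map_neg, map_neg]

theorem liePoisson_prod_inl (b : Module.Basis ι 𝕜 𝔰) (c : Module.Basis Unit 𝕜 𝕜)
    (x : ι ⊕ Unit → 𝕜) (i j : ι) :
    liePoisson (L := 𝔰 × 𝕜) (b.prod c) x (Sum.inl i) (Sum.inl j)
      = liePoisson b (fun k => x (Sum.inl k)) i j := by
  simp [liePoisson]

theorem liePoisson_prod_inr_left (b : Module.Basis ι 𝕜 𝔰) (c : Module.Basis Unit 𝕜 𝕜)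
    (x : ι ⊕ Unit → 𝕜) (u : Unit) (j : ι ⊕ Unit) :
    liePoisson (L := 𝔰 × 𝕜) (b.prod c) x (Sum.inr u) j = 0 := by
  rcases j with j | j <;> simp [liePoisson]

theorem liePoisson_prod_inr_right (b : Module.Basis ι 𝕜 𝔰) (c : Module.Basis Unit 𝕜 𝕜)
    (x : ι ⊕ Unit → 𝕜) (u : Unit) (j : ι ⊕ Unit) :
    liePoisson (L := 𝔰 × 𝕜) (b.prod c) x j (Sum.inr u) = 0 := by
  rcases j with j | j <;> simp [liePoisson]

end Components

end CLPoisson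

namespace CLPoisson

section Extension

variable {𝕜 : Type*} [RCLike 𝕜] {𝔰 : Type*} [LieRing 𝔰] [LieAlgebra 𝕜 𝔰]
  {ι : Type*} [Fintype ι]

theorem differentiable_liePoisson (b : Module.Basis ι 𝕜 𝔰) (i j : ι) :
    Differentiable 𝕜 fun y => liePoisson b y i j := by
  simp only [liePoisson_eq_eval]
  exact differentiable_eval _

variable [DecidableEq ι]

theorem pd_liePoisson (b : Module.Basis ι 𝕜 𝔰) (l i j : ι) (x : ι → 𝕜) :
    pd l (fun y => liePoisson b y i j) x = b.repr ⁅b i, b j⁆ l := by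
  simp only [liePoisson_eq_eval]
  rw [pd_eval, linPoly_apply]
  simp [MvPolynomial.pderiv_X, Pi.single_apply, MvPolynomial.smul_eval]

variable (b : Module.Basis ι 𝕜 𝔰) (c : Module.Basis Unit 𝕜 𝕜)
  {X : (ι → 𝕜) → ι → 𝕜} {q : (ι → 𝕜) → 𝕜}

theorem pd_inl_tildeField_inl (hX : ∀ i, Differentiable 𝕜 fun x => X x i) (i l : ι)
    (x : ι ⊕ Unit → 𝕜) :
    pd (Sum.inl l) (fun y => tildeField X q y (Sum.inl i)) x
      = pd l (fun y => X y i) (fun j => x (Sum.inl j))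
        - x (Sum.inr ()) * if i = l then 1 else 0 := by
  have hd : Differentiable 𝕜 fun z : ι → 𝕜 => z i := by fun_prop
  show pd (Sum.inl l) (fun y : ι ⊕ Unit → 𝕜 =>
    X (fun j => y (Sum.inl j)) i - y (Sum.inr ()) * y (Sum.inl i)) x = _
  rw [pd_sub _ (differentiableAt_comp_inl (F := fun z => X z i) x (hX i _))
    (differentiableAt_mul_comp_inl (F := fun z => z i) x (hd _)),
    pd_inl_comp (F := fun z => X z i) x (hX i _), pd_inl_mul_comp (F := fun z => z i) x (hd _),
    pd_coord]

/-- Linearity of `π₁` gives `L_E π₁ = π₁ - 2π₁ = -π₁`, so `-x₀ E` contributes `x₀ π₁`. Derivatives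
of the factor `x₀` do not enter, since `π₁` has no `x₀` component. -/
theorem lieDer_tildeField_inl_inl (hX : ∀ i, Differentiable 𝕜 fun x => X x i)
    (x : ι ⊕ Unit → 𝕜) (i j : ι) :
    lieDer (tildeField X q) (liePoisson (L := 𝔰 × 𝕜) (b.prod c)) x (Sum.inl i) (Sum.inl j)
      = lieDer X (liePoisson b) (fun j => x (Sum.inl j)) i j
        + x (Sum.inr ()) * liePoisson b (fun j => x (Sum.inl j)) i j := by
  simp only [lieDer, vfAct, Fintype.sum_sum_type, liePoisson_prod_inl, liePoisson_prod_inr_left,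
    liePoisson_prod_inr_right, pd_inl_tildeField_inl hX, zero_mul, Finset.sum_const_zero]
  have hP := fun l => pd_inl_comp (F := fun y => liePoisson b y i j) x
    (differentiable_liePoisson b i j _) l
  have hP0 := pd_inr_comp (F := fun y => liePoisson b y i j) x
    (differentiable_liePoisson b i j _)
  simp only [hP, hP0, pd_liePoisson]
  have hl : liePoisson b (fun j => x (Sum.inl j)) i j
    = ∑ k, b.repr ⁅b i, b j⁆ k * x (Sum.inl k) := rfl
  have hE : ∑ l, tildeField X q x (Sum.inl l) * b.repr ⁅b i, b j⁆ l
      = ∑ l, X (fun j => x (Sum.inl j)) l * b.repr ⁅b i, b j⁆ l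
        - x (Sum.inr ()) * liePoisson b (fun j => x (Sum.inl j)) i j := by
    rw [hl, Finset.mul_sum, ← Finset.sum_sub_distrib]
    refine Finset.sum_congr rfl fun l _ => ?_
    simp only [tildeField, Sum.elim_inl]
    ring
  rw [hE]
  simp only [mul_sub, Finset.sum_sub_distrib, mul_ite, mul_one, mul_zero, Finset.sum_ite_eq,
    Finset.mem_univ, if_true, Finset.sum_const_zero]
  ring

theorem lieDer_tildeField_inl_inr (hq : Differentiable 𝕜 q) (x : ι ⊕ Unit → 𝕜) (i : ι) (u : Unit) :
    lieDer (tildeField X q) (liePoisson (L := 𝔰 × 𝕜) (b.prod c)) x (Sum.inl i) (Sum.inr u)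
      = -ham (liePoisson b) q (fun j => x (Sum.inl j)) i := by
  have hc := fun l => pd_inl_comp (F := q) x (hq _) l
  have hz : ∀ l, pd l (fun _ : ι ⊕ Unit → 𝕜 => (0 : 𝕜)) x = 0 := fun l => pd_zero l x
  simp only [lieDer, vfAct, ham, Fintype.sum_sum_type, liePoisson_prod_inl,
    liePoisson_prod_inr_right, zero_mul, Finset.sum_const_zero, hz,
    mul_zero, tildeField, Sum.elim_inr, hc]
  ring

theorem lieDer_tildeField_inr_inl (hq : Differentiable 𝕜 q) (x : ι ⊕ Unit → 𝕜) (i : ι) (u : Unit) :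
    lieDer (tildeField X q) (liePoisson (L := 𝔰 × 𝕜) (b.prod c)) x (Sum.inr u) (Sum.inl i)
      = ham (liePoisson b) q (fun j => x (Sum.inl j)) i := by
  have hc := fun l => pd_inl_comp (F := q) x (hq _) l
  have hz : ∀ l, pd l (fun _ : ι ⊕ Unit → 𝕜 => (0 : 𝕜)) x = 0 := fun l => pd_zero l x
  simp only [lieDer, vfAct, ham, Fintype.sum_sum_type, liePoisson_prod_inl,
    liePoisson_prod_inr_left, zero_mul, Finset.sum_const_zero, hz,
    mul_zero, tildeField, Sum.elim_inr, hc]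
  simp only [liePoisson_skew b _ _ i, neg_mul, Finset.sum_neg_distrib]
  ring

theorem lieDer_tildeField_inr_inr (x : ι ⊕ Unit → 𝕜) (u v : Unit) :
    lieDer (tildeField X q) (liePoisson (L := 𝔰 × 𝕜) (b.prod c)) x (Sum.inr u) (Sum.inr v) = 0 := by
  have hz : ∀ l, pd l (fun _ : ι ⊕ Unit → 𝕜 => (0 : 𝕜)) x = 0 := fun l => pd_zero l x
  simp only [lieDer, vfAct, liePoisson_prod_inr_left, liePoisson_prod_inr_right, zero_mul,
    Finset.sum_const_zero, hz, mul_zero, sub_zero]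

end Extension

/-! ### Consequences of the Jacobi identity of `π₂` -/

section Jacobi

open MvPolynomial

variable {𝕜 : Type*} [RCLike 𝕜] {ι : Type*} [Fintype ι]

/-- The Lie derivative of a polynomial bivector along a polynomial vector field. -/
noncomputable def polyLieDer (X : ι → MvPolynomial ι 𝕜) (p : ι → ι → MvPolynomial ι 𝕜) (i j : ι) :
    MvPolynomial ι 𝕜 :=
  ∑ l, X l * pderiv l (p i j) - ∑ l, p l j * pderiv l (X i) - ∑ l, p i l * pderiv l (X j)

theorem polyLieDer_skew (X : ι → MvPolynomial ι 𝕜) {p : ι → ι → MvPolynomial ι 𝕜}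
    (hp : ∀ i j, p i j = -p j i) (i j : ι) : polyLieDer X p i j = -polyLieDer X p j i := by
  have h1 : ∑ l, X l * pderiv l (p i j) = -∑ l, X l * pderiv l (p j i) := by
    rw [hp i j, ← Finset.sum_neg_distrib]
    simp
  have h2 : ∀ i j, ∑ l, p l j * pderiv l (X i) = -∑ l, p j l * pderiv l (X i) := fun i j => by
    rw [← Finset.sum_neg_distrib]
    exact Finset.sum_congr rfl fun l _ => by rw [hp l j, neg_mul]
  rw [polyLieDer, polyLieDer, h1, h2 i j, h2 j i]
  ring

variable [DecidableEq ι]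

theorem ham_eq_eval {P : (ι → 𝕜) → ι → ι → 𝕜} {f : (ι → 𝕜) → 𝕜} {p : ι → ι → MvPolynomial ι 𝕜}
    {r : MvPolynomial ι 𝕜} (hP : ∀ x i j, P x i j = eval x (p i j)) (hf : ∀ x, f x = eval x r)
    (x : ι → 𝕜) (i : ι) : ham P f x i = eval x (∑ m, p i m * pderiv m r) := by
  obtain rfl : f = fun x => eval x r := funext hf
  simp [ham, hP, pd_eval]

theorem lieDer_eq_eval {X : (ι → 𝕜) → ι → 𝕜} {P : (ι → 𝕜) → ι → ι → 𝕜}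
    {Y : ι → MvPolynomial ι 𝕜} {p : ι → ι → MvPolynomial ι 𝕜}
    (hX : ∀ i x, X x i = eval x (Y i)) (hP : ∀ x i j, P x i j = eval x (p i j))
    (x : ι → 𝕜) (i j : ι) : lieDer X P x i j = eval x (polyLieDer Y p i j) := by
  simp [lieDer, vfAct, polyLieDer, hX, hP, pd_eval]

variable {P₂ : (ι ⊕ Unit → 𝕜) → ι ⊕ Unit → ι ⊕ Unit → 𝕜} {P Q : ι → ι → MvPolynomial ι 𝕜}
  {D : ι → MvPolynomial ι 𝕜}
  (h11 : ∀ x i j, P₂ x (Sum.inl i) (Sum.inl j)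
    = eval (fun j => x (Sum.inl j)) (Q i j) + x (Sum.inr ()) * eval (fun j => x (Sum.inl j)) (P i j))
  (h12 : ∀ x i u, P₂ x (Sum.inl i) (Sum.inr u) = -eval (fun j => x (Sum.inl j)) (D i))
  (h21 : ∀ x u i, P₂ x (Sum.inr u) (Sum.inl i) = eval (fun j => x (Sum.inl j)) (D i))
  (h22 : ∀ x u v, P₂ x (Sum.inr u) (Sum.inr v) = 0)
  (hJ : ∀ x i j k, ∑ l, (P₂ x i l * pd l (fun y => P₂ y j k) x
    + P₂ x j l * pd l (fun y => P₂ y k i) x + P₂ x k l * pd l (fun y => P₂ y i j) x) = 0)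

include h11

theorem pd_inl_affine (x : ι ⊕ Unit → 𝕜) (l i j : ι) :
    pd (Sum.inl l) (fun y => P₂ y (Sum.inl i) (Sum.inl j)) x
      = eval (fun j => x (Sum.inl j)) (pderiv l (Q i j))
        + x (Sum.inr ()) * eval (fun j => x (Sum.inl j)) (pderiv l (P i j)) := by
  simp only [h11]
  rw [pd_add _ (differentiableAt_comp_inl (F := fun z => eval z (Q i j)) x (differentiable_eval _ _))
    (differentiableAt_mul_comp_inl (F := fun z => eval z (P i j)) x (differentiable_eval _ _)),
    pd_inl_comp (F := fun z => eval z (Q i j)) x (differentiable_eval _ _),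
    pd_inl_mul_comp (F := fun z => eval z (P i j)) x (differentiable_eval _ _), pd_eval, pd_eval]

theorem pd_inr_affine (x : ι ⊕ Unit → 𝕜) (u : Unit) (i j : ι) :
    pd (Sum.inr u) (fun y => P₂ y (Sum.inl i) (Sum.inl j)) x
      = eval (fun j => x (Sum.inl j)) (P i j) := by
  simp only [h11]
  rw [pd_add _ (differentiableAt_comp_inl (F := fun z => eval z (Q i j)) x (differentiable_eval _ _))
    (differentiableAt_mul_comp_inl (F := fun z => eval z (P i j)) x (differentiable_eval _ _)),
    pd_inr_comp (F := fun z => eval z (Q i j)) x (differentiable_eval _ _),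
    pd_inr_mul_comp (F := fun z => eval z (P i j)) x (differentiable_eval _ _), zero_add]

include h12 hJ

theorem compatible_of_jacobi (i j k : ι) :
    ∑ l, (Q i l * pderiv l (P j k) + Q j l * pderiv l (P k i)
      + Q k l * pderiv l (P i j) + P i l * pderiv l (Q j k) + P j l * pderiv l (Q k i)
      + P k l * pderiv l (Q i j)) = 0 := by
  refine MvPolynomial.funext fun y => ?_
  have h := fun t : 𝕜 => hJ (Sum.elim y fun _ => t) (Sum.inl i) (Sum.inl j) (Sum.inl k)
  simp only [Fintype.sum_sum_type, pd_inl_affine h11, pd_inr_affine h11] at h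
  simp only [h11, h12, Sum.elim_inl, Sum.elim_inr] at h
  -- The horizontal Jacobi identity is quadratic in `x₀`. Subtracting its values at `1` and `-1`
  -- isolates twice the linear coefficient; the terms differentiated in `x₀` are constant and
  -- cancel.
  have h1 := (h 1).trans (h (-1)).symm
  rw [← sub_eq_zero, add_sub_add_comm, sub_self, add_zero, ← Finset.sum_sub_distrib] at h1
  have h2 : (2 : 𝕜) ≠ 0 := two_ne_zero
  apply mul_left_cancel₀ h2
  rw [map_zero, mul_zero, ← h1, map_sum, Finset.mul_sum]
  refine Finset.sum_congr rfl fun l _ => ?_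
  simp only [map_add, map_mul]
  ring

include h21 h22

theorem preserves_of_jacobi (i j : ι) :
    ∑ l, (D l * pderiv l (Q i j) - Q i l * pderiv l (D j) + Q j l * pderiv l (D i)) = 0 := by
  refine MvPolynomial.funext fun y => ?_
  -- At `x₀ = 0` the horizontal part is `Q` alone, and the mixed identity says that the field `D`
  -- preserves `Q`.
  have h := hJ (Sum.elim y fun _ => 0) (Sum.inl i) (Sum.inl j) (Sum.inr ())
  have e1 : ∀ (x : ι ⊕ Unit → 𝕜) (l i : ι), pd (Sum.inl l) (fun y => P₂ y (Sum.inl i) (Sum.inr ())) x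
      = -eval (fun j => x (Sum.inl j)) (pderiv l (D i)) := fun x l i => by
    simp only [h12, ← map_neg]
    rw [pd_inl_comp (F := fun z => eval z (-D i)) x (differentiable_eval _ _), pd_eval, map_neg]
  have e2 : ∀ (x : ι ⊕ Unit → 𝕜) (i : ι),
      pd (Sum.inr ()) (fun y => P₂ y (Sum.inl i) (Sum.inr ())) x = 0 := fun x i => by
    simp only [h12, ← map_neg]
    rw [pd_inr_comp (F := fun z => eval z (-D i)) x (differentiable_eval _ _)]
  have e3 : ∀ (x : ι ⊕ Unit → 𝕜) (l i : ι), pd (Sum.inl l) (fun y => P₂ y (Sum.inr ()) (Sum.inl i)) x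
      = eval (fun j => x (Sum.inl j)) (pderiv l (D i)) := fun x l i => by
    simp only [h21]
    rw [pd_inl_comp (F := fun z => eval z (D i)) x (differentiable_eval _ _), pd_eval]
  have e4 : ∀ (x : ι ⊕ Unit → 𝕜) (i : ι),
      pd (Sum.inr ()) (fun y => P₂ y (Sum.inr ()) (Sum.inl i)) x = 0 := fun x i => by
    simp only [h21]
    rw [pd_inr_comp (F := fun z => eval z (D i)) x (differentiable_eval _ _)]
  simp only [Fintype.sum_sum_type, pd_inl_affine h11, pd_inr_affine h11, e1, e2, e3, e4,
    Finset.univ_unique, Finset.sum_singleton, PUnit.default_eq_unit] at h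
  simp only [h11, h12, h21, h22, Sum.elim_inl, Sum.elim_inr, zero_mul, mul_zero, add_zero] at h
  rw [map_zero, ← h, map_sum]
  refine Finset.sum_congr rfl fun l _ => ?_
  simp only [map_add, map_sub, map_mul]
  ring

end Jacobi

end CLPoisson

namespace CLPoisson

/-! ### The Leibniz rule for Casimir functions -/

section Casimir

variable {𝕜 : Type*} [RCLike 𝕜] {ι : Type*} [Fintype ι]

theorem IsHomogPoly.differentiable {d : ℕ} {f : (ι → 𝕜) → 𝕜} (hf : IsHomogPoly d f) :
    Differentiable 𝕜 f := by
  obtain ⟨p, -, hp⟩ := hf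
  rw [show f = fun x => MvPolynomial.eval x p from funext hp]
  exact differentiable_eval p

variable [DecidableEq ι]

theorem ham_add (P : (ι → 𝕜) → ι → ι → 𝕜) {f g : (ι → 𝕜) → 𝕜} (hf : Differentiable 𝕜 f)
    (hg : Differentiable 𝕜 g) (x : ι → 𝕜) (i : ι) :
    ham P (f + g) x i = ham P f x i + ham P g x i := by
  simp only [ham, ← Finset.sum_add_distrib, ← mul_add]
  exact Finset.sum_congr rfl fun j _ => by rw [← pd_add j (hf x) (hg x)]; rfl

theorem vfAct_ham (P : (ι → 𝕜) → ι → ι → 𝕜) (hP : ∀ x i j, P x i j = -P x j i)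
    (f g : (ι → 𝕜) → 𝕜) (x : ι → 𝕜) : vfAct (ham P f) g x = -vfAct (ham P g) f x := by
  simp only [vfAct, ham, Finset.sum_mul]
  rw [Finset.sum_comm, ← Finset.sum_neg_distrib]
  refine Finset.sum_congr rfl fun j _ => ?_
  rw [← Finset.sum_neg_distrib]
  refine Finset.sum_congr rfl fun i _ => ?_
  rw [hP x i j]
  ring

/-- The left side is the Lie derivative along `X` of the field `P(f)`, which is zero. In components,
`h1` differentiates `P(f) = 0`, and `h4` matches the terms where `P` is contracted with a derivative
of `X`. -/
theorem ham_lieDer_add_ham_vfAct {X : (ι → 𝕜) → ι → 𝕜} {P : (ι → 𝕜) → ι → ι → 𝕜}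
    (hX : ∀ i, Differentiable 𝕜 fun x => X x i) (hP : ∀ i j, Differentiable 𝕜 fun x => P x i j)
    {f : (ι → 𝕜) → 𝕜} (hf : ContDiff 𝕜 ∞ f) (hPf : ∀ x, ham P f x = 0) (x : ι → 𝕜) (i : ι) :
    ham (lieDer X P) f x i + ham P (vfAct X f) x i = 0 := by
  have hpf : ∀ j, Differentiable 𝕜 (pd j f) := fun j =>
    differentiable_of_contDiff (contDiff_pd hf j)
  have h1 : ∀ l, ∑ j, (P x i j * pd l (pd j f) x + pd l (fun y => P y i j) x * pd j f x) = 0 := by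
    intro l
    have h : pd l (fun y => ∑ j, P y i j * pd j f y) x = 0 := by
      have : (fun y => ∑ j, P y i j * pd j f y) = fun _ => 0 :=
        funext fun y => congrFun (hPf y) i
      rw [this, pd_zero]
    rw [pd_sum _ _ fun j _ => (hP i j x).fun_mul (hpf j x)] at h
    rw [← h]
    exact Finset.sum_congr rfl fun j _ => (pd_mul l (hP i j x) (hpf j x)).symm
  have h2 : ∀ l, ∑ j, P x l j * pd j f x = 0 := fun l => congrFun (hPf x) l
  have h3 : ∀ j, pd j (vfAct X f) x
      = ∑ l, (X x l * pd l (pd j f) x + pd j (fun y => X y l) x * pd l f x) := fun j => by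
    rw [show vfAct X f = fun y => ∑ l, X y l * pd l f y from rfl,
      pd_sum _ _ fun l _ => (hX l x).fun_mul (hpf l x)]
    refine Finset.sum_congr rfl fun l _ => ?_
    rw [pd_mul j (hX l x) (hpf l x), pd_comm hf]
  have h4 : ∑ j, ∑ l, P x i j * (pd j (fun y => X y l) x * pd l f x)
      = ∑ j, ∑ l, P x i l * (pd l (fun y => X y j) x * pd j f x) := Finset.sum_comm
  have h5 : ∑ j, ∑ l, X x l * (P x i j * pd l (pd j f) x
      + pd l (fun y => P y i j) x * pd j f x) = 0 := by
    rw [Finset.sum_comm]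
    exact Finset.sum_eq_zero fun l _ => by rw [← Finset.mul_sum, h1, mul_zero]
  have h6 : ∑ j, ∑ l, pd l (fun y => X y i) x * (P x l j * pd j f x) = 0 := by
    rw [Finset.sum_comm]
    exact Finset.sum_eq_zero fun l _ => by rw [← Finset.mul_sum, h2, mul_zero]
  have h7 := congrArg₂ (· - ·) (congrArg₂ (· + ·) h5 (sub_eq_zero.mpr h4)) h6
  simp only [add_zero, sub_zero] at h7
  refine Eq.trans ?_ h7
  simp only [ham, lieDer, vfAct, h3, Finset.mul_sum, Finset.sum_mul, ← Finset.sum_add_distrib,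
    ← Finset.sum_sub_distrib]
  refine Finset.sum_congr rfl fun j _ => Finset.sum_congr rfl fun l _ => ?_
  ring

theorem differentiable_vfAct {X : (ι → 𝕜) → ι → 𝕜} (hX : ∀ i, Differentiable 𝕜 fun x => X x i)
    {f : (ι → 𝕜) → 𝕜} (hf : ContDiff 𝕜 ∞ f) : Differentiable 𝕜 (vfAct X f) := by
  have h : ∀ j, Differentiable 𝕜 (pd j f) := fun j =>
    differentiable_of_contDiff (contDiff_pd hf j)
  show Differentiable 𝕜 fun x => ∑ j, X x j * pd j f x
  exact Differentiable.fun_sum fun j _ => (hX j).fun_mul (h j)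

end Casimir

/-! ### Expansion in powers of `x₀` -/

section Expansion

theorem sum_pow_mul_eq_zero_iff {𝕜 : Type*} [RCLike 𝕜] {n : ℕ} {c : ℕ → 𝕜} :
    (∀ t : 𝕜, ∑ m ∈ Finset.range n, t ^ m * c m = 0) ↔ ∀ m < n, c m = 0 := by
  refine ⟨fun h m hm => ?_, fun h t => Finset.sum_eq_zero fun m hm => by
    rw [h m (Finset.mem_range.mp hm), mul_zero]⟩
  have hp : (∑ m ∈ Finset.range n, Polynomial.monomial m (c m)) = 0 := by
    refine Polynomial.funext fun t => ?_
    rw [Polynomial.eval_finsetSum, Polynomial.eval_zero, ← h t]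
    exact Finset.sum_congr rfl fun m _ => by rw [Polynomial.eval_monomial, mul_comm]
  have := congrArg (fun p => Polynomial.coeff p m) hp
  simpa [Polynomial.finsetSum_coeff, Polynomial.coeff_monomial, hm] using this

variable {𝕜 : Type*} [RCLike 𝕜] {ι : Type*} [Fintype ι] [DecidableEq ι]

theorem pd_inl_polyInX0 (k : ℕ) {r : ℕ → (ι → 𝕜) → 𝕜} (hr : ∀ i, Differentiable 𝕜 (r i))
    (x : ι ⊕ Unit → 𝕜) (i : ι) :
    pd (Sum.inl i) (polyInX0 k r) x
      = ∑ m ∈ Finset.range (k + 1), x (Sum.inr ()) ^ m * pd i (r m) fun j => x (Sum.inl j) := by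
  show pd (Sum.inl i) (fun x : ι ⊕ Unit → 𝕜 => ∑ m ∈ Finset.range (k + 1),
    x (Sum.inr ()) ^ m * r m fun j => x (Sum.inl j)) x = _
  rw [pd_sum _ _ fun m _ => (hasFDerivAt_pow_mul m x (hr m _)).differentiableAt]
  exact Finset.sum_congr rfl fun m _ => pd_inl_pow_mul m x (hr m _) i

theorem pd_inr_polyInX0 (k : ℕ) {r : ℕ → (ι → 𝕜) → 𝕜} (hr : ∀ i, Differentiable 𝕜 (r i))
    (x : ι ⊕ Unit → 𝕜) :
    pd (Sum.inr ()) (polyInX0 k r) x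
      = ∑ m ∈ Finset.range k, x (Sum.inr ()) ^ m *
          (((m + 1 : ℕ) : 𝕜) * r (m + 1) fun j => x (Sum.inl j)) := by
  show pd (Sum.inr ()) (fun x : ι ⊕ Unit → 𝕜 => ∑ m ∈ Finset.range (k + 1),
    x (Sum.inr ()) ^ m * r m fun j => x (Sum.inl j)) x = _
  rw [pd_sum _ _ fun m _ => (hasFDerivAt_pow_mul m x (hr m _)).differentiableAt,
    Finset.sum_congr rfl fun m _ => pd_inr_pow_mul m x (hr m _), Finset.sum_range_succ']
  simp only [Nat.cast_zero, zero_mul, add_zero, Nat.add_sub_cancel]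
  exact Finset.sum_congr rfl fun m _ => by ring

/-- The coefficient of `x₀ᵐ` in the horizontal components of `π₂(r)`. -/
noncomputable def hamCoeff (P Q : (ι → 𝕜) → ι → ι → 𝕜) (q : (ι → 𝕜) → 𝕜) (r : ℕ → (ι → 𝕜) → 𝕜) (m : ℕ)
    (y : ι → 𝕜) (i : ι) : 𝕜 :=
  ham Q (r m) y i - ((m + 1 : ℕ) : 𝕜) * r (m + 1) y * ham P q y i
    + if m = 0 then 0 else ham P (r (m - 1)) y i

/-- The vertical component of `P₂(r)` has degree at most `k` in `x₀`. The horizontal ones reach `k +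
1`, because `x₀ P` raises the degree, hence the two ranges of `m`. -/
theorem isCasimir_polyInX0_iff {P₂ : (ι ⊕ Unit → 𝕜) → ι ⊕ Unit → ι ⊕ Unit → 𝕜}
    {P Q : (ι → 𝕜) → ι → ι → 𝕜} {q : (ι → 𝕜) → 𝕜}
    (h11 : ∀ x i j, P₂ x (Sum.inl i) (Sum.inl j)
      = Q (fun j => x (Sum.inl j)) i j + x (Sum.inr ()) * P (fun j => x (Sum.inl j)) i j)
    (h12 : ∀ x i u, P₂ x (Sum.inl i) (Sum.inr u) = -ham P q (fun j => x (Sum.inl j)) i)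
    (h21 : ∀ x u i, P₂ x (Sum.inr u) (Sum.inl i) = ham P q (fun j => x (Sum.inl j)) i)
    (h22 : ∀ x u v, P₂ x (Sum.inr u) (Sum.inr v) = 0)
    (k : ℕ) {r : ℕ → (ι → 𝕜) → 𝕜} (hr : ∀ i, Differentiable 𝕜 (r i)) (hrk : ∀ i, k < i → r i = 0) :
    IsCasimir P₂ (polyInX0 k r) ↔
      (∀ m < k + 1, ∀ y, vfAct (ham P q) (r m) y = 0) ∧
      ∀ m < k + 2, ∀ y i, hamCoeff P Q q r m y i = 0 := by
  have hinl : ∀ x i, ham P₂ (polyInX0 k r) x (Sum.inl i)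
      = ∑ m ∈ Finset.range (k + 2), x (Sum.inr ()) ^ m *
        hamCoeff P Q q r m (fun j => x (Sum.inl j)) i := by
    intro x i
    have hpd : ∀ m > k, ∀ j y, pd j (r m) y = 0 := fun m hm j y => by
      rw [hrk m hm]; exact pd_zero j y
    have hA : ∑ m ∈ Finset.range (k + 2), x (Sum.inr ()) ^ m * ham Q (r m) (fun j => x (Sum.inl j)) i
        = ∑ j, Q (fun j => x (Sum.inl j)) i j * ∑ m ∈ Finset.range (k + 1),
          x (Sum.inr ()) ^ m * pd j (r m) fun j => x (Sum.inl j) := by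
      rw [Finset.sum_range_succ]
      simp only [ham, hpd (k + 1) (Nat.lt_succ_self k), mul_zero, Finset.sum_const_zero, add_zero,
        Finset.mul_sum]
      rw [Finset.sum_comm]
      exact Finset.sum_congr rfl fun m _ => Finset.sum_congr rfl fun j _ => by ring
    have hB : ∑ m ∈ Finset.range (k + 2), x (Sum.inr ()) ^ m *
          (if m = 0 then 0 else ham P (r (m - 1)) (fun j => x (Sum.inl j)) i)
        = ∑ j, x (Sum.inr ()) * P (fun j => x (Sum.inl j)) i j * ∑ m ∈ Finset.range (k + 1),
          x (Sum.inr ()) ^ m * pd j (r m) fun j => x (Sum.inl j) := by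
      rw [Finset.sum_range_succ']
      simp only [ham, if_true, mul_zero, add_zero, Nat.add_one_ne_zero, if_false,
        Nat.add_sub_cancel, Finset.mul_sum]
      rw [Finset.sum_comm]
      exact Finset.sum_congr rfl fun m _ => Finset.sum_congr rfl fun j _ => by ring
    -- The two top terms vanish since `r (k + 1)` and `r (k + 2)` are zero.
    have hC : ∑ m ∈ Finset.range (k + 2), x (Sum.inr ()) ^ m *
          (((m + 1 : ℕ) : 𝕜) * r (m + 1) (fun j => x (Sum.inl j)) *
            ham P q (fun j => x (Sum.inl j)) i)
        = ham P q (fun j => x (Sum.inl j)) i * ∑ m ∈ Finset.range k, x (Sum.inr ()) ^ m *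
          (((m + 1 : ℕ) : 𝕜) * r (m + 1) fun j => x (Sum.inl j)) := by
      rw [Finset.sum_range_succ, Finset.sum_range_succ, hrk (k + 1) (by omega),
        hrk (k + 1 + 1) (by omega), Finset.mul_sum]
      simp only [Pi.zero_apply, mul_zero, zero_mul, add_zero]
      exact Finset.sum_congr rfl fun m _ => by ring
    have hL : ham P₂ (polyInX0 k r) x (Sum.inl i)
      = (∑ j, Q (fun j => x (Sum.inl j)) i j * ∑ m ∈ Finset.range (k + 1),
          x (Sum.inr ()) ^ m * pd j (r m) fun j => x (Sum.inl j))
        - ham P q (fun j => x (Sum.inl j)) i * ∑ m ∈ Finset.range k, x (Sum.inr ()) ^ m *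
          (((m + 1 : ℕ) : 𝕜) * r (m + 1) fun j => x (Sum.inl j))
        + ∑ j, x (Sum.inr ()) * P (fun j => x (Sum.inl j)) i j * ∑ m ∈ Finset.range (k + 1),
          x (Sum.inr ()) ^ m * pd j (r m) fun j => x (Sum.inl j) := by
      rw [ham, Fintype.sum_sum_type]
      simp only [h11, h12, pd_inl_polyInX0 k hr, Finset.univ_unique, Finset.sum_singleton,
        PUnit.default_eq_unit, pd_inr_polyInX0 k hr, add_mul, Finset.sum_add_distrib]
      ring
    rw [hL, ← hA, ← hB, ← hC, ← Finset.sum_sub_distrib, ← Finset.sum_add_distrib]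
    exact Finset.sum_congr rfl fun m _ => by rw [hamCoeff]; ring
  have hinr : ∀ x, ham P₂ (polyInX0 k r) x (Sum.inr ())
      = ∑ m ∈ Finset.range (k + 1), x (Sum.inr ()) ^ m *
        vfAct (ham P q) (r m) fun j => x (Sum.inl j) := by
    intro x
    rw [ham, Fintype.sum_sum_type]
    simp only [h21, h22, pd_inl_polyInX0 k hr, zero_mul, Finset.sum_const_zero, add_zero, vfAct,
      Finset.mul_sum]
    rw [Finset.sum_comm]
    exact Finset.sum_congr rfl fun m _ => Finset.sum_congr rfl fun j _ => by ring
  constructor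
  · intro h
    refine ⟨fun m hm y => ?_, fun m hm y i => ?_⟩
    · refine (sum_pow_mul_eq_zero_iff (c := fun m => vfAct (ham P q) (r m) y)).mp
        (fun t => ?_) m hm
      exact (hinr (Sum.elim y fun _ => t)).symm.trans (congrFun (h _) _)
    · refine (sum_pow_mul_eq_zero_iff (c := fun m => hamCoeff P Q q r m y i)).mp
        (fun t => ?_) m hm
      exact (hinl (Sum.elim y fun _ => t) i).symm.trans (congrFun (h _) _)
  · rintro ⟨h1, h2⟩ x
    funext j
    rcases j with i | u
    · rw [hinl]
      exact Finset.sum_eq_zero fun m hm => by rw [h2 m (Finset.mem_range.mp hm), mul_zero]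
    · rw [hinr]
      exact Finset.sum_eq_zero fun m hm => by rw [h1 m (Finset.mem_range.mp hm), mul_zero]

/-- The four conditions are the cases `m = 0`, `0 < m < k`, `m = k` and `m = k + 1`. For `k = 0` the
first and third cases coincide, so the third is imposed only for `1 ≤ k`. -/
theorem hamCoeff_eq_zero_iff {P Q : (ι → 𝕜) → ι → ι → 𝕜} {q : (ι → 𝕜) → 𝕜} (k : ℕ)
    {r : ℕ → (ι → 𝕜) → 𝕜} (hrk : ∀ i, k < i → r i = 0) :
    (∀ m < k + 2, ∀ y i, hamCoeff P Q q r m y i = 0) ↔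
      (∀ x, ham Q (r 0) x - r 1 x • ham P q x = 0) ∧
      (∀ i, 1 ≤ i → i < k → ∀ x, ham Q (r i) x - ((i + 1 : ℕ) : 𝕜) • r (i + 1) x • ham P q x
          + ham P (r (i - 1)) x = 0) ∧
      (1 ≤ k → ∀ x, ham Q (r k) x + ham P (r (k - 1)) x = 0) ∧
      (∀ x, ham P (r k) x = 0) := by
  have hpd : ∀ m > k, ∀ x i, ham Q (r m) x i = 0 := fun m hm x i => by
    rw [hrk m hm]
    exact Finset.sum_eq_zero fun j _ => by
      rw [show pd j (0 : (ι → 𝕜) → 𝕜) x = 0 from pd_zero j x, mul_zero]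
  have hr1 : ∀ m > k, ∀ x, r m x = 0 := fun m hm x => by rw [hrk m hm]; rfl
  constructor
  · intro h
    refine ⟨fun x => funext fun i => ?_, fun m hm hmk x => funext fun i => ?_,
      fun hk x => funext fun i => ?_, fun x => funext fun i => ?_⟩
    · simpa [hamCoeff] using h 0 (by omega) x i
    · have := h m (by omega) x i
      rw [hamCoeff, if_neg (by omega)] at this
      refine Eq.trans ?_ this
      simp [mul_assoc]
    · have := h k (by omega) x i
      rw [hamCoeff, if_neg (by omega), hr1 (k + 1) (by omega)] at this
      simpa using this
    · have := h (k + 1) (by omega) x i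
      rw [hamCoeff, if_neg (by omega), hr1 (k + 1 + 1) (by omega), hpd (k + 1) (by omega)] at this
      simpa using this
  · rintro ⟨h0, h1, h2, h3⟩ m hm y i
    rcases Nat.eq_zero_or_pos m with rfl | hm0
    · simpa [hamCoeff] using congrFun (h0 y) i
    rw [hamCoeff, if_neg (by omega)]
    rcases lt_trichotomy m k with hmk | rfl | hmk
    · have := congrFun (h1 m hm0 hmk y) i
      refine Eq.trans ?_ this
      simp [mul_assoc]
    · rw [hr1 (m + 1) (by omega)]
      simpa using congrFun (h2 hm0 y) i
    · obtain rfl : m = k + 1 := by omega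
      rw [hr1 (k + 1 + 1) (by omega), hpd (k + 1) (by omega)]
      simpa using congrFun (h3 y) i

end Expansion

/-! ### Fields preserving `π₁`, and the vanishing of `π(f) q` -/

section Semisimple

open MvPolynomial

variable {𝕜 : Type*} [RCLike 𝕜] {𝔰 : Type*} [LieRing 𝔰] [LieAlgebra 𝕜 𝔰]
  {ι : Type*} [Fintype ι]

/-- A homogeneous polynomial vector field preserving the Lie–Poisson bivector of a semisimple Lie
algebra annihilates its Casimir functions. -/
theorem sum_mul_pd_eq_zero_of_isCasimir [LieAlgebra.IsSemisimple 𝕜 𝔰] [DecidableEq ι]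
    (b : Module.Basis ι 𝕜 𝔰) {d : ℕ}
    {Z : ι → MvPolynomial ι 𝕜} (hZ : ∀ i, (Z i).IsHomogeneous (d + 1))
    (hpres : ∀ i j, ∑ l, (Z l * pderiv l (linPoly b ⁅b i, b j⁆)
      - linPoly b ⁅b i, b l⁆ * pderiv l (Z j) + linPoly b ⁅b j, b l⁆ * pderiv l (Z i)) = 0)
    {f : (ι → 𝕜) → 𝕜} (hf : IsCasimir (liePoisson b) f) (x : ι → 𝕜) :
    ∑ i, eval x (Z i) * pd i f x = 0 := by
  obtain ⟨h, hh⟩ := exists_hamiltonian_of_homogeneous b Z hZ fun i j => by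
    rw [lieDerivation_apply, lieDerivation_apply, ← sub_eq_zero, ← hpres i j]
    simp only [Finset.sum_add_distrib, Finset.sum_sub_distrib]
    ring
  have hv : ∀ i, eval x (Z i) = ham (liePoisson b) (fun y => eval y h) x i := fun i => by
    rw [hh, lieDerivation_apply, ham_eq_eval (liePoisson_eq_eval b) (fun _ => rfl)]
  have h1 := vfAct_ham (liePoisson b) (liePoisson_skew b) (fun y => eval y h) f x
  simp only [hv]
  refine Eq.trans h1 ?_
  rw [vfAct, neg_eq_zero]
  exact Finset.sum_eq_zero fun i _ => by rw [hf x, Pi.zero_apply, zero_mul]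

theorem polyLieDer_isHomogeneous {X : ι → MvPolynomial ι 𝕜} (hX : ∀ i, (X i).IsHomogeneous 2)
    {p : ι → ι → MvPolynomial ι 𝕜} (hp : ∀ i j, (p i j).IsHomogeneous 1) (i j : ι) :
    (polyLieDer X p i j).IsHomogeneous 2 := by
  have h1 : (∑ l, X l * pderiv l (p i j)).IsHomogeneous 2 :=
    IsHomogeneous.sum _ _ _ fun l _ => (hX l).mul (hp i j).pderiv
  have h2 : (∑ l, p l j * pderiv l (X i)).IsHomogeneous 2 :=
    IsHomogeneous.sum _ _ _ fun l _ => (hp l j).mul (hX i).pderiv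
  have h3 : (∑ l, p i l * pderiv l (X j)).IsHomogeneous 2 :=
    IsHomogeneous.sum _ _ _ fun l _ => (hp i l).mul (hX j).pderiv
  exact (h1.sub h2).sub h3

/-- If `π₂ = [X̃, π₁]` is Poisson then, for a Casimir function `f` of the Lie–Poisson bivector of a
semisimple Lie algebra, `q` is annihilated by `[X, π₁](f)`. -/
theorem vfAct_ham_lieDer_eq_zero [LieAlgebra.IsSemisimple 𝕜 𝔰] [DecidableEq ι]
    (b : Module.Basis ι 𝕜 𝔰) (c : Module.Basis Unit 𝕜 𝕜) {X : (ι → 𝕜) → ι → 𝕜}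
    (hX : ∀ i, IsHomogPoly 2 fun x => X x i) {q : (ι → 𝕜) → 𝕜} (hq : IsHomogPoly 2 q)
    (hJ : IsQuadraticPoisson
      (lieDer (tildeField X q) (liePoisson (L := 𝔰 × 𝕜) (b.prod c))))
    {f : (ι → 𝕜) → 𝕜} (hf : IsCasimir (liePoisson b) f) (x : ι → 𝕜) :
    vfAct (ham (lieDer X (liePoisson b)) f) q x = 0 := by
  have hXd := fun i => (hX i).differentiable
  have hqd := hq.differentiable
  choose Y hY hXY using hX
  obtain ⟨s, hs, hqs⟩ := hq
  let p : ι → ι → MvPolynomial ι 𝕜 := fun i j => linPoly b ⁅b i, b j⁆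
  have hp : ∀ i j, p i j = -p j i := fun i j => by
    simp only [p]
    rw [← lie_skew, map_neg]
  have hP := liePoisson_eq_eval b
  have hQ := lieDer_eq_eval (p := p) hXY hP
  have hQskew : ∀ x i j, lieDer X (liePoisson b) x i j = -lieDer X (liePoisson b) x j i :=
    fun x i j => by rw [hQ, hQ, polyLieDer_skew Y hp, map_neg]
  have hD := ham_eq_eval hP hqs
  have h11 := lieDer_tildeField_inl_inl (q := q) b c hXd
  have h12 := lieDer_tildeField_inl_inr (X := X) b c hqd
  have h21 := fun x (u : Unit) i => lieDer_tildeField_inr_inl (X := X) b c hqd x i u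
  have h22 := lieDer_tildeField_inr_inr (X := X) (q := q) b c
  simp only [hQ, hD, hP] at h11 h12 h21
  -- Here `P = π₁` and `Q = π`: the cubic field `π(q)` preserves `π₁`, hence annihilates `f`.
  have hham := ham_preserves_of_compatible p (polyLieDer Y p) s hp (polyLieDer_skew Y hp)
    (compatible_of_jacobi (P := p) h11 h12 hJ.jacobi)
    (preserves_of_jacobi h11 h12 h21 h22 hJ.jacobi)
  have hZh : ∀ i, (∑ m, polyLieDer Y p i m * pderiv m s).IsHomogeneous (2 + 1) := fun i =>
    IsHomogeneous.sum _ _ _ fun m _ =>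
      (polyLieDer_isHomogeneous hY (fun i j => linPoly_isHomogeneous b _) i m).mul hs.pderiv
  rw [vfAct_ham _ hQskew, neg_eq_zero, ← sum_mul_pd_eq_zero_of_isCasimir b hZh hham hf x]
  simp only [vfAct, ham_eq_eval hQ hqs]

end Semisimple

end CLPoisson

theorem mainTheorem9 {𝕜 : Type*} [RCLike 𝕜]
    {𝔰 : Type*} [LieRing 𝔰] [LieAlgebra 𝕜 𝔰] [LieAlgebra.IsSemisimple 𝕜 𝔰]
    {ι : Type*} [Fintype ι] [DecidableEq ι]
    -- linear coordinates `xᵢ` on `𝔰*`, and `x₀` on `𝔤* = (𝔰 ⊕ 𝕜)*` normalized by `x₀(a) = 1`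
    (b : Module.Basis ι 𝕜 𝔰) (c : Module.Basis Unit 𝕜 𝕜)
    (a : Module.Dual 𝕜 (𝔰 × 𝕜)) (ha : a (0, c ()) = 1)
    -- a CL quadratic Poisson bivector `π₂ = [X + q ∂/∂x₀ - x₀ E, π₁]` on `𝔤*`
    (π₂ : (ι ⊕ Unit → 𝕜) → ι ⊕ Unit → ι ⊕ Unit → 𝕜)
    (hCL : CLPoisson.IsCentrallyLinearizableAt (b.prod c) π₂ a)
    (X : (ι → 𝕜) → ι → 𝕜) (hX : ∀ i, CLPoisson.IsHomogPoly 2 fun x => X x i)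
    (q : (ι → 𝕜) → 𝕜) (hq : CLPoisson.IsHomogPoly 2 q)
    (hform : π₂ = CLPoisson.lieDer (CLPoisson.tildeField X q) (CLPoisson.liePoisson (L := 𝔰 × 𝕜) (b.prod c)))
    -- `π₁` on `𝔰*`, and `π = [X, π₁]`
    (π₁ π : (ι → 𝕜) → ι → ι → 𝕜)
    (hπ₁ : π₁ = CLPoisson.liePoisson b) (hπ : π = CLPoisson.lieDer X π₁) :
    (∀ (k : ℕ) (r : ℕ → (ι → 𝕜) → 𝕜), (∀ i, ContDiff 𝕜 ∞ (r i)) → (∀ i, k < i → r i = 0) →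
      (CLPoisson.IsCasimir π₂ (CLPoisson.polyInX0 k r) ↔
        (∀ i, i ≤ k → ∀ x, CLPoisson.vfAct (CLPoisson.ham π₁ q) (r i) x = 0) ∧
        (∀ x, CLPoisson.ham π (r 0) x - r 1 x • CLPoisson.ham π₁ q x = 0) ∧
        (∀ i, 1 ≤ i → i < k → ∀ x,
          CLPoisson.ham π (r i) x - ((i + 1 : ℕ) : 𝕜) • r (i + 1) x • CLPoisson.ham π₁ q x
            + CLPoisson.ham π₁ (r (i - 1)) x = 0) ∧
        (1 ≤ k → ∀ x, CLPoisson.ham π (r k) x + CLPoisson.ham π₁ (r (k - 1)) x = 0) ∧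
        (∀ x, CLPoisson.ham π₁ (r k) x = 0))) ∧
    (∀ f f' : (ι → 𝕜) → 𝕜, ContDiff 𝕜 ∞ f → ContDiff 𝕜 ∞ f' →
      (∀ x, CLPoisson.ham π₁ f x = 0) → CLPoisson.IsCasimir π₁ f' →
        (∀ x, CLPoisson.ham π f x + CLPoisson.ham π₁ (CLPoisson.vfAct X f + f') x = 0) ∧
        (∀ x, CLPoisson.vfAct (CLPoisson.ham π₁ q) (CLPoisson.vfAct X f + f') x = 0)) := by
  have hXd := fun i => (hX i).differentiable
  have hqd := hq.differentiable
  subst hform hπ hπ₁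
  refine ⟨fun k r hr hrk => ?_, fun f f' hf hf' hPf hPf' => ?_⟩
  · rw [CLPoisson.isCasimir_polyInX0_iff
      (CLPoisson.lieDer_tildeField_inl_inl (q := q) b c hXd)
      (CLPoisson.lieDer_tildeField_inl_inr (X := X) b c hqd)
      (fun x u i => CLPoisson.lieDer_tildeField_inr_inl (X := X) b c hqd x i u)
      (CLPoisson.lieDer_tildeField_inr_inr (X := X) (q := q) b c) k
      (fun i => CLPoisson.differentiable_of_contDiff (hr i)) hrk,
      CLPoisson.hamCoeff_eq_zero_iff k hrk]
    simp only [Nat.lt_succ_iff]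
  · have hham : ∀ x, CLPoisson.ham (CLPoisson.lieDer X (CLPoisson.liePoisson b)) f x
        + CLPoisson.ham (CLPoisson.liePoisson b) (CLPoisson.vfAct X f + f') x = 0 := fun x => by
      funext i
      rw [Pi.add_apply, CLPoisson.ham_add _ (CLPoisson.differentiable_vfAct hXd hf)
        (CLPoisson.differentiable_of_contDiff hf'), hPf' x, Pi.zero_apply, add_zero]
      exact CLPoisson.ham_lieDer_add_ham_vfAct hXd (CLPoisson.differentiable_liePoisson b)
        hf hPf x i
    refine ⟨hham, fun x => ?_⟩
    -- With `g = X f + f'`, skew-symmetry and the identity just proved give `π₁(q) g = -π₁(g) q =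
    -- π(f) q`, which is zero.
    rw [CLPoisson.vfAct_ham _ (CLPoisson.liePoisson_skew b),
      ← CLPoisson.vfAct_ham_lieDer_eq_zero b c hX hq hCL.quadraticPoisson hPf x]
    simp only [CLPoisson.vfAct, eq_neg_of_add_eq_zero_left (hham x), Pi.neg_apply, neg_mul,
      Finset.sum_neg_distrib]
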